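/- Throughout, partitions are identified with their (ordinary) Young diagrams, and strict partitions $\lambda=(\lambda_1>\dots>\lambda_\ell>0)$, $\ell=\ell(\lambda)$, with their shifted Young diagrams (row $i$ occupies columns $i,\dots,i+\lambda_i-1$). The content of a box is its column number minus its row number. Write $\sigma\nearrow\rho$ (resp. $\mu\Nearrow\lambda$) if the ordinary (resp. shifted) diagram $\rho$ (resp. $\lambda$) is obtained from $\sigma$ (resp. $\mu$) by adding one box. Let $f_\rho$ (resp. $g_\lambda$) be the number of paths from $\varnothing$ to $\rho$ along $\nearrow$ (resp. from $\varnothing$ to $\lambda$ along $\Nearrow$). The Plancherel measures are $\mathrm{Pl}_n(\rho)=f_\rho^2/n!$ on partitions $\rho$ of $n$ and $\mathbb{Pl}_n(\lambda)=2^{n-\ell(\lambda)}g_\lambda^2/n!$ on strict partitions $\lambda$ of $n$. The corresponding up transition probabilities are $$p^\uparrow_{\mathrm{Pl}}(\sigma,\rho)=\frac{f_\sigma}{f_\rho}\cdot\frac{\mathrm{Pl}_{n+1}(\rho)}{\mathrm{Pl}_n(\sigma)}\quad(\sigma\nearrow\rho,\ |\sigma|=n),\qquad p^\Uparrow_{\mathbb{Pl}}(\mu,\lambda)=\frac{g_\mu}{g_\lambda}\cdot\frac{\mathbb{Pl}_{n+1}(\lambda)}{\mathbb{Pl}_n(\mu)}\quad(\mu\Nearrow\lambda,\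 |\mu|=n),$$ and $0$ for all other pairs. The doubling $\mathcal{D}\lambda$ of a strict partition $\lambda$ is the partition of $2|\lambda|$ with Frobenius coordinates $(\lambda_1,\dots,\lambda_\ell\mid\lambda_1-1,\dots,\lambda_\ell-1)$. For an ordinary diagram $\rho$ put $$\mathcal{R}^\uparrow(u;\rho)=\frac{\prod_{y}(u-y)}{\prod_{x}(u-x)},$$ where $y$ (resp. $x$) runs over the contents of the boxes that can be removed from (resp. added to) $\rho$. For a strict partition $\lambda$ put $$\mathcal{R}^\Uparrow(v;\lambda)=\frac{\prod_{y}(v-y(y+1))}{v\prod_{x}(v-x(x+1))},$$ where $y$ runs over the contents of the boxes that can be removed from the shifted diagram $\lambda$, and $x$ over the nonzero contents of the boxes that can be added to it. **Proposition.** (1) For every strict partition $\lambda$, one has the identity of rational functions in $u$ over $\mathbb{C}$ $$(u-1)\cdot\mathcal{R}^\Uparrow(u(u-1);\lambda)=\mathcal{R}^\uparrow(u;\mathcal{D}\lambda).$$ (2) Let $\mu\Nearrow\lambda$ be strict partitions. If $\ell(\lambda)=\ell(\mu)$, then there are exactly two ordinary diagrams $\rho^{(a)}\neq\rho^{(b)}$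 with $\mathcal{D}\mu\nearrow\rho^{(a)},\rho^{(b)}\nearrow\mathcal{D}\lambda$, and $$p^\Uparrow_{\mathbb{Pl}}(\mu,\lambda)=p^\uparrow_{\mathrm{Pl}}(\mathcal{D}\mu,\rho^{(a)})+p^\uparrow_{\mathrm{Pl}}(\mathcal{D}\mu,\rho^{(b)}).$$ Otherwise $\ell(\lambda)=\ell(\mu)+1$, there is exactly one ordinary diagram $\rho$ with $\mathcal{D}\mu\nearrow\rho\nearrow\mathcal{D}\lambda$, and $$p^\Uparrow_{\mathbb{Pl}}(\mu,\lambda)=p^\uparrow_{\mathrm{Pl}}(\mathcal{D}\mu,\rho).$$ -/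

import Mathlib

/-! ### Graded graphs: paths, down and up transition probabilities -/

/-- Directed paths `a → ⋯ → b` along the edge relation `E`. -/
inductive GraphPath {V : Type} (E : V → V → Prop) (a : V) : V → Type
  | nil : GraphPath E a a
  | snoc {b c : V} (p : GraphPath E a b) (h : E b c) : GraphPath E a c

/-- The number of directed paths from `a` to `b`. -/
noncomputable def numPaths {V : Type} (E : V → V → Prop) (a b : V) : ℕ :=
  Nat.card (GraphPath E a b)

open Classical in
/-- Down transition probability from `y` to `x` on a graph with edges `E` and initial vertex
`root`: the ratio `dim x / dim y` if `x` is joined to `y` by an edge going up from `x` to `y`,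
and `0` otherwise; here `dim` is the number of paths from `root`. -/
noncomputable def downProb {V : Type} (E : V → V → Prop) (root : V) (y x : V) : ℝ :=
  if E x y then (numPaths E root x : ℝ) / (numPaths E root y : ℝ) else 0

open Classical in
/-- Up transition probability from `x` to `y` of a system of measures on the levels of the graph.
The system `(Mₙ)` is given by the single function `M` on vertices, `M v = M_{|v|}({v})`. -/
noncomputable def upProb {V : Type} (E : V → V → Prop) (root : V) (M : V → ℝ) (x y : V) : ℝ :=
  if E x y then downProb E root y x * M y / M x else 0

/-- The content (column minus row) of a box `(row, column)`. -/
def boxContent (b : ℕ × ℕ) : ℤ := (b.2 : ℤ) - (b.1 : ℤ)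

/-! ### The Young graph -/

/-- `σ ↗ ρ`: the diagram `ρ` is obtained from `σ` by adding one box. -/
def YoungDiagram.Covers (σ ρ : YoungDiagram) : Prop :=
  σ ≤ ρ ∧ ρ.card = σ.card + 1

/-- The number `f_ρ` of paths from `∅` to `ρ` in the Young graph. -/
noncomputable def YoungDiagram.dim (ρ : YoungDiagram) : ℕ :=
  numPaths YoungDiagram.Covers ⊥ ρ

/-- The Plancherel measure `Plₙ(ρ) = f_ρ² / n!`, `n = |ρ|`. -/
noncomputable def YoungDiagram.plancherel (ρ : YoungDiagram) : ℝ :=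
  (ρ.dim : ℝ) ^ 2 / (ρ.card.factorial : ℝ)

/-- The Plancherel up transition probabilities on the Young graph. -/
noncomputable def YoungDiagram.plancherelUp (σ ρ : YoungDiagram) : ℝ :=
  upProb YoungDiagram.Covers ⊥ YoungDiagram.plancherel σ ρ

/-- Boxes that can be added to `ρ`. -/
def YoungDiagram.addable (ρ : YoungDiagram) : Set (ℕ × ℕ) :=
  {b | ∃ ρ' : YoungDiagram, ρ.Covers ρ' ∧ b ∈ ρ' ∧ b ∉ ρ}

/-- Boxes that can be removed from `ρ`. -/
def YoungDiagram.removable (ρ : YoungDiagram) : Set (ℕ × ℕ) :=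
  {b | ∃ σ : YoungDiagram, σ.Covers ρ ∧ b ∈ ρ ∧ b ∉ σ}

theorem YoungDiagram.addable_finite (ρ : YoungDiagram) : ρ.addable.Finite := by
  have key : ∀ b ∈ ρ.addable, ∀ c : ℕ × ℕ, c ≤ b → c ≠ b → c ∈ ρ := by
    rintro b ⟨ρ', ⟨hle, hcard⟩, hb, hb'⟩ c hc hne
    have hc' : c ∈ ρ' := ρ'.isLowerSet hc hb
    by_contra hcρ
    have hsub : insert b (insert c ρ.cells) ⊆ ρ'.cells := by
      intro x hx
      simp only [Finset.mem_insert] at hx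
      rcases hx with rfl | rfl | hx
      · exact hb
      · exact hc'
      · exact YoungDiagram.cells_subset_iff.2 hle hx
    have h1 := Finset.card_le_card hsub
    rw [Finset.card_insert_of_notMem, Finset.card_insert_of_notMem] at h1
    · change ρ.card + 1 + 1 ≤ ρ'.card at h1
      omega
    · exact hcρ
    · simp only [Finset.mem_insert, not_or]
      exact ⟨fun h => hne h.symm, hb'⟩
  refine (Set.finite_Iic (ρ.colLen 0, ρ.rowLen 0)).subset ?_
  rintro ⟨i, j⟩ hb
  refine ⟨?_, ?_⟩
  · by_contra h
    have h' : ρ.colLen 0 < i := not_le.1 h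
    have := key _ hb (ρ.colLen 0, 0) ⟨h'.le, Nat.zero_le _⟩
      (fun e => h'.ne (congrArg Prod.fst e))
    rw [YoungDiagram.mem_iff_lt_colLen] at this
    exact lt_irrefl _ this
  · by_contra h
    have h' : ρ.rowLen 0 < j := not_le.1 h
    have := key _ hb (0, ρ.rowLen 0) ⟨Nat.zero_le _, h'.le⟩
      (fun e => h'.ne (congrArg Prod.snd e))
    rw [YoungDiagram.mem_iff_lt_rowLen] at this
    exact lt_irrefl _ this

theorem YoungDiagram.removable_finite (ρ : YoungDiagram) : ρ.removable.Finite :=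
  ρ.cells.finite_toSet.subset fun _ ⟨_, _, hb, _⟩ => hb

/-- The rational function `∏ (u - y) / ∏ (u - x)`, where `y` and `x` run over the contents of the
boxes that can be removed from, respectively added to, `ρ`. -/
noncomputable def YoungDiagram.kerovR (ρ : YoungDiagram) : RatFunc ℂ :=
  (∏ b ∈ ρ.removable_finite.toFinset, (RatFunc.X - RatFunc.C (boxContent b : ℂ))) /
    ∏ b ∈ ρ.addable_finite.toFinset, (RatFunc.X - RatFunc.C (boxContent b : ℂ))

/-! ### Strict partitions and the Schur graph -/

/-- A strict partition: a weakly decreasing sequence of nonnegative integers, finitely many of them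
nonzero, whose nonzero members are distinct. Rows are numbered from `0`. -/
@[ext]
structure StrictPartition where
  part : ℕ →₀ ℕ
  antitone : Antitone part
  strict : ∀ i j, part i ≠ 0 → part i = part j → i = j

namespace StrictPartition

/-- The empty partition. -/
def empty : StrictPartition where
  part := 0
  antitone := fun _ _ _ => le_rfl
  strict := fun _ _ h _ => absurd rfl h

/-- The weight `|lam|`. -/
def weight (lam : StrictPartition) : ℕ := ∑ i ∈ lam.part.support, lam.part i

/-- The number `ℓ(lam)` of nonzero parts. -/
def length (lam : StrictPartition) : ℕ := lam.part.support.card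

/-- The boxes of the shifted Young diagram: row `i` occupies the columns
`i, i + 1, …, i + lam_i - 1`. -/
def cells (lam : StrictPartition) : Finset (ℕ × ℕ) :=
  lam.part.support.biUnion fun i => {i} ×ˢ Finset.Ico i (i + lam.part i)

theorem mem_cells (lam : StrictPartition) (i j : ℕ) :
    (i, j) ∈ lam.cells ↔ i ≤ j ∧ j < i + lam.part i := by
  simp only [cells, Finset.mem_biUnion, Finsupp.mem_support_iff, Finset.mem_product,
    Finset.mem_singleton, Finset.mem_Ico]
  constructor
  · rintro ⟨k, _, rfl, h⟩
    exact h
  · rintro h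
    exact ⟨i, by omega, rfl, h⟩

/-- `mu ⇗ lam`: the shifted diagram of `lam` is obtained from that of `mu` by adding one box. -/
def Covers (mu lam : StrictPartition) : Prop :=
  mu.cells ⊆ lam.cells ∧ lam.weight = mu.weight + 1

/-- The number `g_lam` of paths from `∅` to `lam` in the Schur graph. -/
noncomputable def dim (lam : StrictPartition) : ℕ := numPaths Covers empty lam

/-- The Plancherel measure `2^(n - ℓ(lam)) g_lam² / n!`, `n = |lam|`, on strict partitions. -/
noncomputable def plancherel (lam : StrictPartition) : ℝ :=
  (2 : ℝ) ^ ((lam.weight : ℤ) - (lam.length : ℤ)) * (lam.dim : ℝ) ^ 2 /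
    (lam.weight.factorial : ℝ)

/-- The Plancherel up transition probabilities on the Schur graph. -/
noncomputable def plancherelUp (mu lam : StrictPartition) : ℝ :=
  upProb Covers empty plancherel mu lam

/-- Boxes that can be added to the shifted diagram of `lam`. -/
def addable (lam : StrictPartition) : Set (ℕ × ℕ) :=
  {b | ∃ nu : StrictPartition, lam.Covers nu ∧ b ∈ nu.cells ∧ b ∉ lam.cells}

/-- Boxes that can be removed from the shifted diagram of `lam`. -/
def removable (lam : StrictPartition) : Set (ℕ × ℕ) :=
  {b | ∃ mu : StrictPartition, mu.Covers lam ∧ b ∈ lam.cells ∧ b ∉ mu.cells}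

theorem removable_finite (lam : StrictPartition) : lam.removable.Finite :=
  lam.cells.finite_toSet.subset fun _ ⟨_, _, hb, _⟩ => hb

theorem part_succ_lt (lam : StrictPartition) (i : ℕ) (h : lam.part i ≠ 0) :
    lam.part (i + 1) < lam.part i := by
  refine lt_of_le_of_ne (lam.antitone (Nat.le_succ i)) fun e => ?_
  have := lam.strict i (i + 1) h e.symm
  omega

theorem add_part_le (lam : StrictPartition) {i k : ℕ} (hik : i ≤ k) (hk : lam.part k ≠ 0) :
    k + lam.part k ≤ i + lam.part i := by
  induction k, hik using Nat.le_induction with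
  | base => exact le_rfl
  | succ k hik ih =>
    have h0 : lam.part k ≠ 0 := fun h => hk (by
      have := lam.antitone (Nat.le_succ k)
      rw [h] at this
      exact Nat.le_zero.1 this)
    have := lam.part_succ_lt k h0
    have := ih h0
    omega

theorem addable_finite (lam : StrictPartition) : lam.addable.Finite := by
  refine (Set.finite_Iic (lam.weight + 1, lam.weight + 1)).subset ?_
  rintro ⟨i, j⟩ ⟨nu, ⟨_, hw⟩, hb, _⟩
  rw [mem_cells] at hb
  have h1 : nu.part i ≠ 0 := by omega
  have hj : j < 0 + nu.part 0 := lt_of_lt_of_le hb.2 (nu.add_part_le (Nat.zero_le i) h1)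
  have h0 : nu.part 0 ≤ nu.weight := by
    have h00 : nu.part 0 ≠ 0 := by omega
    exact Finset.single_le_sum (f := fun i => nu.part i) (fun _ _ => Nat.zero_le _)
      (Finsupp.mem_support_iff.2 h00)
  exact ⟨by show i ≤ _; omega, by show j ≤ _; omega⟩

open Classical in
/-- The rational function `∏ (v - y (y + 1)) / (v ∏ (v - x (x + 1)))`, where `y` runs over the
contents of the boxes that can be removed from `lam` and `x` runs over the nonzero contents of
the boxes that can be added to `lam`. -/
noncomputable def kerovR (lam : StrictPartition) : RatFunc ℂ :=
  (∏ b ∈ lam.removable_finite.toFinset,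
      (RatFunc.X - RatFunc.C ((boxContent b : ℂ) * ((boxContent b : ℂ) + 1)))) /
    (RatFunc.X * ∏ b ∈ lam.addable_finite.toFinset with boxContent b ≠ 0,
      (RatFunc.X - RatFunc.C ((boxContent b : ℂ) * ((boxContent b : ℂ) + 1))))

/-- The boxes of the diagram with Frobenius coordinates
`(lam_1, …, lam_ℓ | lam_1 - 1, …, lam_ℓ - 1)`: the union over `i` of the hooks with corner `(i, i)`,
arm length `lam_i` and leg length `lam_i - 1`. -/
def doubleCells (lam : StrictPartition) : Finset (ℕ × ℕ) :=
  lam.part.support.biUnion fun i =>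
    ({i} ×ˢ Finset.Icc i (i + lam.part i)) ∪ (Finset.Icc i (i + (lam.part i - 1)) ×ˢ {i})

theorem mem_doubleCells (lam : StrictPartition) (a b : ℕ) :
    (a, b) ∈ lam.doubleCells ↔ lam.part (min a b) ≠ 0 ∧
      a < min a b + lam.part (min a b) ∧ b ≤ min a b + lam.part (min a b) := by
  simp only [doubleCells, Finset.mem_biUnion, Finsupp.mem_support_iff, Finset.mem_union,
    Finset.mem_product, Finset.mem_singleton, Finset.mem_Icc]
  constructor
  · rintro ⟨i, h0, ⟨rfl, h1, h2⟩ | ⟨⟨h1, h2⟩, rfl⟩⟩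
    · rw [min_eq_left h1]
      exact ⟨h0, by omega, h2⟩
    · rw [min_eq_right h1]
      exact ⟨h0, by omega, by omega⟩
  · rintro ⟨h0, h1, h2⟩
    refine ⟨min a b, h0, ?_⟩
    rcases le_total a b with h | h
    · rw [min_eq_left h] at *
      exact Or.inl ⟨rfl, h, h2⟩
    · rw [min_eq_right h] at *
      exact Or.inr ⟨⟨h, by omega⟩, rfl⟩

/-- The doubling `D lam`, an ordinary Young diagram. -/
def double (lam : StrictPartition) : YoungDiagram where
  cells := lam.doubleCells
  isLowerSet := by
    rintro ⟨a, b⟩ ⟨a', b'⟩ ⟨ha, hb⟩ h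
    change a' ≤ a at ha
    change b' ≤ b at hb
    rw [Finset.mem_coe, mem_doubleCells] at h ⊢
    obtain ⟨h0, h1, h2⟩ := h
    have hm : min a' b' ≤ min a b := min_le_min ha hb
    have h3 := lam.add_part_le hm h0
    have h4 := lam.antitone hm
    exact ⟨by omega, by omega, by omega⟩

end StrictPartition

/-!
Both parts compare two rational functions with prescribed zeros and poles. On either graph, `𝓡` can
be written as a product over all rows instead of over corners, since a row that ends at no corner
contributes a pole cancelling the zero of the next one. A hook-type product formula for the number
of paths then shows that the up transition probability to a new vertex is the residue of `𝓡` at the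
pole belonging to the added box.

The product over rows is in turn a telescoped product over all boxes of a factor depending only on
the content. The double of `λ` consists of the boxes of the shifted diagram of `λ`, moved one column
to the right, together with their transposes, so a box of content `c` contributes the factors of
contents `c + 1` and `-c`; multiplied together they depend on `u` only through `u (u - 1)`. This is
the identity of part (1).

Adding a box of content `p` to `μ` adds boxes of contents `p + 1` and `-p` to its double, and these
are the two roots of `u (u - 1) = p (p + 1)`. Taking residues of (1) there splits the transition
probability on the Schur graph in the proportions `p / (2 p + 1)` and `(p + 1) / (2 p + 1)`. For
`p = 0`, that is, when the length increases, the first box becomes available only after the second.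
-/

open Finset Filter Topology

namespace GraphPath

variable {V : Type} {E : V → V → Prop}

theorem finite {rank : V → ℕ} (rank_lt : ∀ {c b}, E c b → rank c < rank b)
    (finite_predecessors : ∀ b, {c | E c b}.Finite) (a b : V) : Finite (GraphPath E a b) := by
  induction hn : rank b using Nat.strong_induction_on generalizing b with
  | _ n ih =>
    have finite_preds : Finite {c // E c b} := finite_predecessors b
    have finite_paths (c : {c // E c b}) : Finite (GraphPath E a c.1) :=
      ih _ (hn ▸ rank_lt c.2) _ rfl
    let dropLast : GraphPath E a b → Option (Σ c : {c // E c b}, GraphPath E a c.1)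
      | .nil => none
      | .snoc p h => some ⟨⟨_, h⟩, p⟩
    refine Finite.of_injective dropLast ?_
    rintro (_ | ⟨p, h⟩) (_ | ⟨q, h'⟩) hpq
    all_goals simp_all [dropLast]

end GraphPath

section
variable {V : Type} {E : V → V → Prop}

theorem numPaths_self {a : V} (not_edge : ∀ c, ¬ E c a) : numPaths E a a = 1 := by
  have : Unique (GraphPath E a a) :=
    { default := .nil
      uniq := fun
        | .nil => rfl
        | .snoc _ h => absurd h (not_edge _) }
  exact Nat.card_unique

theorem numPaths_eq_sum {a b : V} (hab : a ≠ b) (s : Finset V) (mem_s : ∀ c, c ∈ s ↔ E c b)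
    [∀ c, Finite (GraphPath E a c)] : numPaths E a b = ∑ c ∈ s, numPaths E a c := by
  let append : (Σ c : s, GraphPath E a c.1) → GraphPath E a b :=
    fun q => .snoc q.2 ((mem_s _).1 q.1.2)
  have append_bijective : append.Bijective := by
    constructor
    · rintro ⟨⟨c, hc⟩, p⟩ ⟨⟨d, hd⟩, q⟩ h
      simp only [append, GraphPath.snoc.injEq] at h
      obtain ⟨rfl, h⟩ := h
      rw [eq_of_heq h]
    · rintro (_ | ⟨p, h⟩)
      · exact absurd rfl hab
      · exact ⟨⟨⟨_, (mem_s _).2 h⟩, p⟩, rfl⟩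
  rw [numPaths, ← Nat.card_eq_of_bijective append append_bijective, Nat.card_sigma]
  exact sum_coe_sort s fun c => numPaths E a c

end

theorem antitone_support_eq_range_card {f : ℕ →₀ ℕ} (hf : Antitone f) :
    f.support = range f.support.card := by
  have exists_zero : ∃ n, f n = 0 := by
    obtain ⟨n, hn⟩ := Infinite.exists_notMem_finset f.support
    exact ⟨n, Finsupp.notMem_support_iff.1 hn⟩
  have support_eq : f.support = range (Nat.find exists_zero) := by
    ext i
    rw [Finsupp.mem_support_iff, mem_range, Nat.lt_find_iff]
    exact ⟨fun hi m hm h0 => hi (Nat.le_zero.1 (h0 ▸ hf hm)), fun h => h i le_rfl⟩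
  rw [support_eq, card_range]

theorem exists_eq_add_single_of_degree_eq {ι : Type*} {f g : ι →₀ ℕ} (hle : f ≤ g)
    (hdegree : g.degree = f.degree + 1) : ∃ i, g = f + Finsupp.single i 1 := by
  obtain ⟨d, rfl⟩ := le_iff_exists_add.1 hle
  rw [map_add, add_right_inj] at hdegree
  obtain ⟨i, hi⟩ : ∃ i, d = Finsupp.single i 1 := by
    have := (Finsupp.sum_eq_one_iff d).1 hdegree
    simpa using this
  exact ⟨i, by rw [hi]⟩

/-- A graph of finite diagrams, starting at the empty one, in which row `i` of `v` consists of
`row v i` boxes from column `s i` on and an edge adds one box. Young diagrams have `s i = 0`,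
shifted Young diagrams `s i = i`. -/
structure IsRowGraph {V : Type} (E : V → V → Prop) (root : V) (row : V → ℕ →₀ ℕ)
    (cells : V → Finset (ℕ × ℕ)) (s : ℕ → ℕ) : Prop where
  row_injective : row.Injective
  row_root : row root = 0
  row_antitone (v : V) : Antitone (row v)
  mem_cells {v : V} {i j : ℕ} : (i, j) ∈ cells v ↔ s i ≤ j ∧ j < s i + row v i
  edge_iff {u v : V} : E u v ↔ cells u ⊆ cells v ∧ (row v).degree = (row u).degree + 1

namespace IsRowGraph

variable {V : Type} {E : V → V → Prop} {root : V} {row : V → ℕ →₀ ℕ}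
  {cells : V → Finset (ℕ × ℕ)} {s : ℕ → ℕ}

theorem row_le_of_cells_subset (h : IsRowGraph E root row cells s) {u v : V}
    (huv : cells u ⊆ cells v) : row u ≤ row v := fun i => by
  by_contra! hlt
  have := h.mem_cells.1 (huv (h.mem_cells.2 ⟨le_self_add, Nat.add_lt_add_left hlt (s i)⟩))
  omega

theorem cells_eq_insert (h : IsRowGraph E root row cells s) {u v : V} {i : ℕ}
    (huv : row v = row u + Finsupp.single i 1) :
    cells v = insert (i, s i + row u i) (cells u) := by
  ext ⟨a, b⟩
  rw [mem_insert, h.mem_cells, h.mem_cells, huv, Prod.mk.injEq, Finsupp.add_apply,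
    Finsupp.single_apply]
  by_cases hia : i = a
  · subst hia
    simp only [if_true, true_and]
    omega
  · simp [hia, Ne.symm hia]

theorem notMem_cells (h : IsRowGraph E root row cells s) (u : V) (i : ℕ) :
    (i, s i + row u i) ∉ cells u := fun hmem => lt_irrefl _ (h.mem_cells.1 hmem).2

theorem edge_iff_exists (h : IsRowGraph E root row cells s) {u v : V} :
    E u v ↔ ∃ i, row v = row u + Finsupp.single i 1 := by
  rw [h.edge_iff]
  constructor
  · rintro ⟨hsub, hdegree⟩
    exact exists_eq_add_single_of_degree_eq (h.row_le_of_cells_subset hsub) hdegree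
  · rintro ⟨i, hi⟩
    rw [h.cells_eq_insert hi, hi, map_add, Finsupp.degree_single]
    exact ⟨subset_insert _ _, rfl⟩

theorem mem_support_iff (h : IsRowGraph E root row cells s) {v : V} {i : ℕ} :
    i ∈ (row v).support ↔ i < (row v).support.card := by
  rw [← mem_range, ← antitone_support_eq_range_card (h.row_antitone v)]

theorem row_eq_zero (h : IsRowGraph E root row cells s) {v : V} {i : ℕ}
    (hi : (row v).support.card ≤ i) : row v i = 0 :=
  Finsupp.notMem_support_iff.1 fun hmem => (h.mem_support_iff.1 hmem).not_ge hi

theorem prod_cells (h : IsRowGraph E root row cells s) {M : Type*} [CommMonoid M] (v : V)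
    (f : ℕ × ℕ → M) : ∏ b ∈ cells v, f b =
      ∏ i ∈ range (row v).support.card, ∏ j ∈ range (row v i), f (i, s i + j) := by
  rw [prod_finset_product (cells v) (range (row v).support.card)
    fun i => Ico (s i) (s i + row v i)]
  · refine prod_congr rfl fun i _ => ?_
    rw [prod_Ico_eq_prod_range, Nat.add_sub_cancel_left]
  · rintro ⟨i, j⟩
    rw [h.mem_cells, mem_range, mem_Ico, ← h.mem_support_iff, Finsupp.mem_support_iff]
    dsimp only
    omega

theorem lt_card_support (h : IsRowGraph E root row cells s) {u v : V} {i : ℕ}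
    (huv : row v = row u + Finsupp.single i 1) : i < (row v).support.card := by
  rw [← h.mem_support_iff, huv]
  simp

theorem le_card_support (h : IsRowGraph E root row cells s) {u v : V} {i : ℕ}
    (huv : row v = row u + Finsupp.single i 1) : i ≤ (row u).support.card := by
  by_contra! hlt
  have row_v_le : row v i ≤ row v (row u).support.card := h.row_antitone v hlt.le
  simp [huv, hlt.ne, h.row_eq_zero le_rfl] at row_v_le

theorem card_support_le {u v : V} {i : ℕ} (huv : row v = row u + Finsupp.single i 1) :
    (row u).support.card ≤ (row v).support.card :=
  card_le_card (Finsupp.support_mono (huv ▸ le_self_add))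

theorem card_support_le_succ {u v : V} {i : ℕ}
    (huv : row v = row u + Finsupp.single i 1) :
    (row v).support.card ≤ (row u).support.card + 1 := by
  rw [huv]
  refine (card_le_card Finsupp.support_add).trans ((card_union_le _ _).trans ?_)
  exact Nat.add_le_add_left (card_le_card Finsupp.support_single_subset) _

theorem eq_of_mem_cells (h : IsRowGraph E root row cells s) {u v : V} {i : ℕ} {b : ℕ × ℕ}
    (huv : row v = row u + Finsupp.single i 1) (hv : b ∈ cells v) (hu : b ∉ cells u) :
    b = (i, s i + row u i) := by
  rw [h.cells_eq_insert huv, mem_insert] at hv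
  exact hv.resolve_right hu

theorem prod_addable (h : IsRowGraph E root row cells s) {u : V} {A : Finset (ℕ × ℕ)}
    (mem_A : ∀ b, b ∈ A ↔ ∃ v, E u v ∧ b ∈ cells v ∧ b ∉ cells u) {P : ℕ → Prop} [DecidablePred P]
    (exists_iff : ∀ i, (∃ v, row v = row u + Finsupp.single i 1) ↔ P i) {M : Type*} [CommMonoid M]
    (f : ℕ × ℕ → M) : ∏ b ∈ A, f b =
      ∏ i ∈ range ((row u).support.card + 1) with P i, f (i, s i + row u i) := by
  rw [← prod_image (g := fun i => (i, s i + row u i)) fun _ _ _ _ => congrArg Prod.fst]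
  refine prod_congr (ext fun b => ?_) fun _ _ => rfl
  simp only [mem_A, mem_image, mem_filter, mem_range, ← exists_iff]
  constructor
  · rintro ⟨v, hE, hv, hu⟩
    obtain ⟨i, hi⟩ := h.edge_iff_exists.1 hE
    exact ⟨i, ⟨Nat.lt_succ_iff.2 (h.le_card_support hi), v, hi⟩,
      (h.eq_of_mem_cells hi hv hu).symm⟩
  · rintro ⟨i, ⟨-, v, hi⟩, rfl⟩
    exact ⟨v, h.edge_iff_exists.2 ⟨i, hi⟩, h.cells_eq_insert hi ▸ mem_insert_self _ _,
      h.notMem_cells u i⟩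

theorem prod_removable (h : IsRowGraph E root row cells s) {v : V} {R : Finset (ℕ × ℕ)}
    (mem_R : ∀ b, b ∈ R ↔ ∃ u, E u v ∧ b ∈ cells v ∧ b ∉ cells u) {P : ℕ → Prop} [DecidablePred P]
    (exists_iff : ∀ i, (∃ u, row v = row u + Finsupp.single i 1) ↔ P i) {M : Type*} [CommMonoid M]
    (f : ℕ × ℕ → M) : ∏ b ∈ R, f b =
      ∏ i ∈ range (row v).support.card with P i, f (i, s i + (row v i - 1)) := by
  rw [← prod_image (g := fun i => (i, s i + (row v i - 1))) fun _ _ _ _ => congrArg Prod.fst]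
  refine prod_congr (ext fun b => ?_) fun _ _ => rfl
  simp only [mem_R, mem_image, mem_filter, mem_range, ← exists_iff]
  have last_box {u : V} {i : ℕ} (hi : row v = row u + Finsupp.single i 1) :
      (i, s i + (row v i - 1)) = (i, s i + row u i) := by simp [hi]
  constructor
  · rintro ⟨u, hE, hv, hu⟩
    obtain ⟨i, hi⟩ := h.edge_iff_exists.1 hE
    exact ⟨i, ⟨h.lt_card_support hi, u, hi⟩,
      (last_box hi).trans (h.eq_of_mem_cells hi hv hu).symm⟩
  · rintro ⟨i, ⟨-, u, hi⟩, rfl⟩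
    rw [last_box hi]
    exact ⟨u, h.edge_iff_exists.2 ⟨i, hi⟩, h.cells_eq_insert hi ▸ mem_insert_self _ _,
      h.notMem_cells u i⟩

theorem not_edge_root (h : IsRowGraph E root row cells s) (c : V) : ¬ E c root := fun hc => by
  simpa [h.row_root] using (h.edge_iff.1 hc).2

theorem finite_predecessors (h : IsRowGraph E root row cells s) (b : V) : {c | E c b}.Finite := by
  refine ((Set.finite_Iic (row b)).preimage h.row_injective.injOn).subset fun c hc => ?_
  obtain ⟨i, hi⟩ := h.edge_iff_exists.1 hc
  exact (le_self_add : row c ≤ _).trans_eq hi.symm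

theorem numPaths_eq {K : Type*} [Field K] [CharZero K] (h : IsRowGraph E root row cells s)
    {F : V → K} (F_root : F root = 1) (down : V → ℕ → K)
    (F_mul_degree : ∀ {c b i}, row b = row c + Finsupp.single i 1 →
      F c * (row b).degree = F b * down b i)
    (exists_predecessor : ∀ {b i}, i ∈ (row b).support → down b i ≠ 0 →
      ∃ c, row b = row c + Finsupp.single i 1)
    (sum_down : ∀ b, ∑ i ∈ (row b).support, down b i = (row b).degree) (b : V) :
    (numPaths E root b : K) = F b := by
  have finite_paths (c : V) : Finite (GraphPath E root c) :=
    GraphPath.finite (rank := fun v => (row v).degree)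
      (fun hcb => by rw [(h.edge_iff.1 hcb).2]; exact Nat.lt_succ_self _)
      h.finite_predecessors root c
  induction hn : (row b).degree generalizing b with
  | zero =>
    obtain rfl : b = root :=
      h.row_injective (((Finsupp.degree_eq_zero_iff _).1 hn).trans h.row_root.symm)
    rw [numPaths_self h.not_edge_root, Nat.cast_one, F_root]
  | succ n ih =>
    have hb : root ≠ b := by
      rintro rfl
      simp [h.row_root] at hn
    have degree_ne_zero : ((row b).degree : K) ≠ 0 := by
      exact_mod_cast hn.trans_ne n.succ_ne_zero
    let preds := (h.finite_predecessors b).toFinset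
    have mem_preds (c : V) : c ∈ preds ↔ E c b := Set.Finite.mem_toFinset _
    have sum_F : ∑ c ∈ preds, F c * (row b).degree = ∑ i ∈ (row b).support, F b * down b i := by
      choose! i hi using fun c hc => h.edge_iff_exists.1 ((mem_preds c).1 hc)
      refine sum_bij_ne_zero (fun c _ _ => i c) (fun c hc _ => ?_) (fun c hc _ d hd _ hcd => ?_)
        (fun j hj hne => ?_) fun c hc _ => F_mul_degree (hi c hc)
      · rw [Finsupp.mem_support_iff, hi c hc]
        simp
      · have := (hi c hc).symm.trans (hi d hd)
        rw [hcd] at this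
        exact h.row_injective (add_right_cancel this)
      · obtain ⟨c, hc⟩ := exists_predecessor hj (right_ne_zero_of_mul hne)
        have hcs : c ∈ preds := (mem_preds c).2 (h.edge_iff_exists.2 ⟨j, hc⟩)
        have hij : i c = j := Finsupp.single_left_injective one_ne_zero
          (add_left_cancel ((hi c hcs).symm.trans hc))
        exact ⟨c, hcs, by rwa [F_mul_degree hc], hij⟩
    rw [numPaths_eq_sum hb preds mem_preds, Nat.cast_sum,
      sum_congr rfl fun c hc => ih c (by have := (h.edge_iff.1 ((mem_preds c).1 hc)).2; omega)]
    rw [← sum_mul, ← mul_sum, sum_down b] at sum_F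
    exact mul_right_cancel₀ degree_ne_zero sum_F

end IsRowGraph

section
variable {ι K : Type*} [Field K] [DecidableEq ι]

/-- The coefficient of `1 / (z - x i)`, up to sign, in the partial fraction expansion of
`∏ j ∈ s, (1 - t j / (z - x j))`; see `prod_one_sub_div_eq`. -/
def partialFractionCoeff (s : Finset ι) (x t : ι → K) (i : ι) : K :=
  t i * ∏ j ∈ s.erase i, (1 - t j / (x i - x j))

variable {s : Finset ι} {x : ι → K} (t : ι → K)

theorem partialFractionCoeff_insert_self {a : ι} (ha : a ∉ s) :
    partialFractionCoeff (insert a s) x t a = t a * ∏ j ∈ s, (1 - t j / (x a - x j)) := by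
  rw [partialFractionCoeff, erase_insert ha]

theorem partialFractionCoeff_insert_of_mem {a i : ι} (ha : a ∉ s) (hi : i ∈ s) :
    partialFractionCoeff (insert a s) x t i =
      partialFractionCoeff s x t i + t a * (partialFractionCoeff s x t i / (x a - x i)) := by
  have ha' : a ∉ s.erase i := fun h => ha (mem_of_mem_erase h)
  rw [partialFractionCoeff, partialFractionCoeff,
    erase_insert_of_ne (ne_of_mem_of_not_mem hi ha).symm, prod_insert ha', ← neg_sub (x a) (x i),
    div_neg]
  ring

theorem prod_one_sub_div_eq (hx : Set.InjOn x s) {z : K} (hz : ∀ i ∈ s, z ≠ x i) :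
    ∏ i ∈ s, (1 - t i / (z - x i)) = 1 - ∑ i ∈ s, partialFractionCoeff s x t i / (z - x i) := by
  induction s using Finset.induction_on generalizing z with
  | empty => simp
  | insert a s ha ih =>
    rw [coe_insert, Set.injOn_insert (by exact_mod_cast ha)] at hx
    have hxa : ∀ i ∈ s, x a ≠ x i := fun i hi h => hx.2 ⟨i, hi, h.symm⟩
    rw [forall_mem_insert] at hz
    have hza : z - x a ≠ 0 := sub_ne_zero.2 hz.1
    have sum_insert_coeff : ∑ i ∈ s, partialFractionCoeff (insert a s) x t i / (z - x i) =
        ∑ i ∈ s, partialFractionCoeff s x t i / (z - x i) - t a / (z - x a) *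
          (∑ i ∈ s, partialFractionCoeff s x t i / (z - x i) -
            ∑ i ∈ s, partialFractionCoeff s x t i / (x a - x i)) := by
      rw [← sum_sub_distrib, mul_sum, ← sum_sub_distrib]
      refine sum_congr rfl fun i hi => ?_
      have hzi : z - x i ≠ 0 := sub_ne_zero.2 (hz.2 i hi)
      have hai : x a - x i ≠ 0 := sub_ne_zero.2 (hxa i hi)
      rw [partialFractionCoeff_insert_of_mem t ha hi]
      field_simp
      ring
    rw [prod_insert ha, sum_insert ha, ih hx.1 hz.2, partialFractionCoeff_insert_self t ha,
      ih hx.1 hxa, sum_insert_coeff]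
    ring

theorem sum_partialFractionCoeff (hx : Set.InjOn x s) :
    ∑ i ∈ s, partialFractionCoeff s x t i = ∑ i ∈ s, t i := by
  induction s using Finset.induction_on with
  | empty => rfl
  | insert a s ha ih =>
    rw [coe_insert, Set.injOn_insert (by exact_mod_cast ha)] at hx
    have hxa : ∀ i ∈ s, x a ≠ x i := fun i hi h => hx.2 ⟨i, hi, h.symm⟩
    rw [sum_insert ha, sum_insert ha, ← ih hx.1, partialFractionCoeff_insert_self t ha,
      prod_one_sub_div_eq t hx.1 hxa,
      sum_congr rfl fun i hi => partialFractionCoeff_insert_of_mem t ha hi, sum_add_distrib,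
      ← mul_sum]
    ring

theorem two_mul_sum_mul_partialFractionCoeff (hx : Set.InjOn x s) :
    2 * ∑ i ∈ s, x i * partialFractionCoeff s x t i =
      2 * ∑ i ∈ s, x i * t i - ((∑ i ∈ s, t i) ^ 2 - ∑ i ∈ s, t i ^ 2) := by
  induction s using Finset.induction_on with
  | empty => simp
  | insert a s ha ih =>
    rw [coe_insert, Set.injOn_insert (by exact_mod_cast ha)] at hx
    have hxa : ∀ i ∈ s, x a ≠ x i := fun i hi h => hx.2 ⟨i, hi, h.symm⟩
    have sum_insert_coeff : ∑ i ∈ s, x i * partialFractionCoeff (insert a s) x t i =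
        ∑ i ∈ s, x i * partialFractionCoeff s x t i + t a *
          (x a * ∑ i ∈ s, partialFractionCoeff s x t i / (x a - x i) - ∑ i ∈ s, t i) := by
      rw [← sum_partialFractionCoeff t hx.1, mul_sum, ← sum_sub_distrib, mul_sum,
        ← sum_add_distrib]
      refine sum_congr rfl fun i hi => ?_
      have hai : x a - x i ≠ 0 := sub_ne_zero.2 (hxa i hi)
      rw [partialFractionCoeff_insert_of_mem t ha hi]
      field_simp
      ring
    rw [sum_insert ha, sum_insert_coeff, partialFractionCoeff_insert_self t ha,
      prod_one_sub_div_eq t hx.1 hxa]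
    simp only [sum_insert ha]
    linear_combination ih hx.1

end

theorem prod_erase_comp_update {α M : Type*} [CommMonoid M] (f : α → M) (l : ℕ → α) (s : Finset ℕ)
    (a : ℕ) (x : α) : ∏ j ∈ s.erase a, f (Function.update l a x j) = ∏ j ∈ s.erase a, f (l j) :=
  prod_congr rfl fun j hj => by rw [Function.update_of_ne (ne_of_mem_erase hj)]

section
variable {ι R : Type*} [CommRing R]

/-- The product of `h (l j) (l i)` over the pairs `j < i < k`, a Vandermonde-type product. -/
def pairProd (h : ι → ι → R) (k : ℕ) (l : ℕ → ι) : R :=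
  ∏ i ∈ range k, ∏ j ∈ range i, h (l j) (l i)

theorem pairProd_succ (h : ι → ι → R) (k : ℕ) (l : ℕ → ι) :
    pairProd h (k + 1) l = pairProd h k l * ∏ j ∈ range k, h (l j) (l k) :=
  prod_range_succ ..

theorem pairProd_congr (h : ι → ι → R) {k : ℕ} {l l' : ℕ → ι} (hl : ∀ j < k, l j = l' j) :
    pairProd h k l = pairProd h k l' :=
  prod_congr rfl fun i hi => prod_congr rfl fun j hj => by
    rw [hl i (mem_range.1 hi), hl j ((mem_range.1 hj).trans (mem_range.1 hi))]

theorem exists_pairProd_update_eq {h : ι → ι → R} (antisymm : ∀ x y, h x y = -h y x)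
    (l : ℕ → ι) {k a : ℕ} (ha : a < k) :
    ∃ Q, ∀ x, pairProd h k (Function.update l a x) = Q * ∏ j ∈ (range k).erase a, h x (l j) := by
  induction k, ha using Nat.le_induction with
  | base =>
    refine ⟨pairProd h a l * (-1) ^ a, fun x => ?_⟩
    rw [pairProd_succ, range_add_one, erase_insert notMem_range_self, Function.update_self,
      pairProd_congr h fun j hj => Function.update_of_ne hj.ne x l,
      prod_congr rfl fun j hj => by
        rw [Function.update_of_ne (mem_range.1 hj).ne, antisymm, neg_eq_neg_one_mul],
      prod_mul_distrib, prod_const, card_range, mul_assoc]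
  | succ k hak ih =>
    obtain ⟨Q, hQ⟩ := ih
    have hka : k ≠ a := by omega
    refine ⟨Q * ∏ j ∈ (range k).erase a, h (l j) (l k), fun x => ?_⟩
    rw [pairProd_succ, hQ, range_add_one, erase_insert_of_ne hka, prod_insert (by simp),
      Function.update_of_ne hka,
      ← mul_prod_erase (range k) (fun j => h (Function.update l a x j) _) (mem_range.2 hak),
      Function.update_self, prod_erase_comp_update fun y => h y (l k)]
    ring

end

section
variable {K : Type*} [Field K]

/-- The common shape of Frobenius' formula for the number of standard tableaux and Schur's formula
for the number of shifted ones, up to the factor `n!`. -/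
def pairQuotient (h : ℕ → ℕ → K) (k : ℕ) (l : ℕ → ℕ) : K :=
  pairProd h k l / ∏ j ∈ range k, ((l j).factorial : K)

variable [CharZero K] {h : ℕ → ℕ → K} {k a : ℕ} {l : ℕ → ℕ}

theorem pairQuotient_ne_zero (hne : ∀ i j, j < i → i < k → h (l j) (l i) ≠ 0) :
    pairQuotient h k l ≠ 0 :=
  div_ne_zero
    (prod_ne_zero_iff.2 fun i hi => prod_ne_zero_iff.2 fun j hj =>
      hne i j (mem_range.1 hj) (mem_range.1 hi))
    (prod_ne_zero_iff.2 fun j _ => Nat.cast_ne_zero.2 (l j).factorial_ne_zero)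

theorem pairQuotient_update_succ_mul (antisymm : ∀ x y, h x y = -h y x) (ha : a < k) :
    pairQuotient h k (Function.update l a (l a + 1)) *
        ((l a + 1) * ∏ j ∈ (range k).erase a, h (l a) (l j)) =
      pairQuotient h k l * ∏ j ∈ (range k).erase a, h (l a + 1) (l j) := by
  obtain ⟨Q, hQ⟩ := exists_pairProd_update_eq antisymm l ha
  have pairProd_eq := hQ (l a)
  rw [Function.update_eq_self] at pairProd_eq
  have prod_factorial_ne_zero : ∏ j ∈ (range k).erase a, ((l j).factorial : K) ≠ 0 :=
    prod_ne_zero_iff.2 fun j _ => Nat.cast_ne_zero.2 (l j).factorial_ne_zero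
  have factorial_ne_zero : ((l a).factorial : K) ≠ 0 :=
    Nat.cast_ne_zero.2 (l a).factorial_ne_zero
  have succ_ne_zero : (l a : K) + 1 ≠ 0 := Nat.cast_add_one_ne_zero _
  rw [pairQuotient, pairQuotient, hQ, pairProd_eq,
    ← mul_prod_erase (range k) _ (mem_range.2 ha), ← mul_prod_erase (range k) _ (mem_range.2 ha),
    Function.update_self, Nat.factorial_succ, prod_erase_comp_update fun y : ℕ => (y.factorial : K)]
  push_cast
  field_simp

theorem pairQuotient_eq_update_succ_mul (antisymm : ∀ x y, h x y = -h y x) (ha : a < k)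
    (hne : ∀ j ∈ (range k).erase a, h (l a + 1) (l j) ≠ 0) :
    pairQuotient h k l = pairQuotient h k (Function.update l a (l a + 1)) *
      ((l a + 1) * ∏ j ∈ (range k).erase a, h (l a) (l j) / h (l a + 1) (l j)) := by
  rw [prod_div_distrib, mul_div_assoc', mul_div_assoc', pairQuotient_update_succ_mul antisymm ha,
    mul_div_cancel_right₀ _ (prod_ne_zero_iff.2 hne)]

theorem pairQuotient_update_succ_div (antisymm : ∀ x y, h x y = -h y x) (ha : a < k)
    (hne : ∀ i j, i ≠ j → i < k → j < k → h (l j) (l i) ≠ 0) :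
    pairQuotient h k (Function.update l a (l a + 1)) / pairQuotient h k l =
      (∏ j ∈ (range k).erase a, h (l a + 1) (l j) / h (l a) (l j)) / (l a + 1) := by
  have prod_ne_zero : ∏ j ∈ (range k).erase a, h (l a) (l j) ≠ 0 := prod_ne_zero_iff.2 fun j hj =>
    hne j a (ne_of_mem_erase hj) (mem_range.1 (mem_of_mem_erase hj)) ha
  have succ_ne_zero : (l a : K) + 1 ≠ 0 := Nat.cast_add_one_ne_zero _
  rw [prod_div_distrib, div_div, div_eq_div_iff, mul_comm (∏ j ∈ _, h (l a) (l j)),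
    pairQuotient_update_succ_mul antisymm ha, mul_comm]
  · exact pairQuotient_ne_zero fun i j hji hi => hne i j hji.ne' hi (hji.trans hi)
  · exact mul_ne_zero prod_ne_zero succ_ne_zero

end

namespace YoungGraph

/-- The row lengths of a Young diagram. -/
noncomputable def rows (ρ : YoungDiagram) : ℕ →₀ ℕ :=
  Finsupp.onFinset (range (ρ.colLen 0)) ρ.rowLen fun _ hi =>
    mem_range.2 (YoungDiagram.mem_iff_lt_colLen.1
      (YoungDiagram.mem_iff_lt_rowLen.2 (Nat.pos_of_ne_zero hi)))

theorem mem_cells_iff {ρ : YoungDiagram} {i j : ℕ} : (i, j) ∈ ρ.cells ↔ j < rows ρ i :=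
  YoungDiagram.mem_iff_lt_rowLen

theorem rows_injective : rows.Injective := fun σ ρ h => by
  ext ⟨i, j⟩
  rw [mem_cells_iff, mem_cells_iff, h]

theorem rows_antitone (ρ : YoungDiagram) : Antitone (rows ρ) := fun i j => ρ.rowLen_anti i j

theorem exists_rows_eq {f : ℕ →₀ ℕ} (hf : Antitone f) : ∃ ρ, rows ρ = f := by
  let boxes := f.support.biUnion fun i => {i} ×ˢ range (f i)
  have mem_boxes (i j : ℕ) : (i, j) ∈ boxes ↔ j < f i := by
    simp only [boxes, mem_biUnion, Finsupp.mem_support_iff, mem_product, mem_singleton, mem_range]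
    exact ⟨fun ⟨_, _, rfl, h⟩ => h, fun h => ⟨i, h.ne_bot, rfl, h⟩⟩
  let ρ : YoungDiagram :=
    { cells := boxes
      isLowerSet := fun ⟨a, b⟩ ⟨a', b'⟩ ⟨haa', hbb'⟩ hab => by
        rw [mem_coe, mem_boxes] at hab ⊢
        exact lt_of_le_of_lt hbb' (hab.trans_le (hf haa')) }
  exact ⟨ρ, Finsupp.ext fun i => eq_of_forall_lt_iff fun j =>
    mem_cells_iff.symm.trans (mem_boxes i j)⟩

theorem card_eq_degree_rows (ρ : YoungDiagram) : ρ.card = (rows ρ).degree := by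
  rw [YoungDiagram.card, card_eq_sum_ones,
    sum_finset_product ρ.cells (rows ρ).support fun i => range (rows ρ i)]
  · simp [Finsupp.degree_apply]
  · rintro ⟨i, j⟩
    rw [mem_cells_iff, Finsupp.mem_support_iff, mem_range]
    exact ⟨fun h => ⟨h.ne_bot, h⟩, And.right⟩

theorem isRowGraph : IsRowGraph YoungDiagram.Covers ⊥ rows YoungDiagram.cells fun _ => 0 where
  row_injective := rows_injective
  row_root := (Finsupp.degree_eq_zero_iff _).1 (card_eq_degree_rows ⊥).symm
  row_antitone := rows_antitone
  mem_cells := mem_cells_iff.trans (by rw [zero_add]; exact (and_iff_right (Nat.zero_le _)).symm)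
  edge_iff := by
    intro σ ρ
    rw [YoungDiagram.Covers, YoungDiagram.cells_subset_iff, card_eq_degree_rows,
      card_eq_degree_rows]

theorem exists_rows_eq_add_single_iff {σ : YoungDiagram} {i : ℕ} :
    (∃ ρ, rows ρ = rows σ + Finsupp.single i 1) ↔ i = 0 ∨ rows σ i < rows σ (i - 1) := by
  constructor
  · rintro ⟨ρ, hρ⟩
    have := rows_antitone ρ (Nat.sub_le i 1)
    rw [hρ] at this
    simp only [Finsupp.add_apply, Finsupp.single_apply] at this
    grind
  · intro hi
    refine exists_rows_eq (antitone_nat_of_succ_le fun j => ?_)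
    have := rows_antitone σ (Nat.le_succ j)
    simp only [Finsupp.add_apply, Finsupp.single_apply]
    grind

theorem exists_add_single_eq_rows_iff {ρ : YoungDiagram} {i : ℕ} :
    (∃ σ, rows ρ = rows σ + Finsupp.single i 1) ↔ rows ρ (i + 1) < rows ρ i := by
  constructor
  · rintro ⟨σ, hσ⟩
    have := rows_antitone σ (Nat.le_succ i)
    rw [hσ]
    simp only [Finsupp.add_apply, Finsupp.single_apply]
    grind
  · intro hi
    obtain ⟨σ, hσ⟩ := exists_rows_eq (f := rows ρ - Finsupp.single i 1)
      (antitone_nat_of_succ_le fun j => by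
        have := rows_antitone ρ (Nat.le_succ j)
        simp only [Finsupp.tsub_apply, Finsupp.single_apply]
        grind)
    refine ⟨σ, ?_⟩
    rw [hσ, tsub_add_cancel_of_le (Finsupp.single_le_iff.2 (by omega))]

end YoungGraph

namespace StrictPartition

theorem exists_part_eq {f : ℕ →₀ ℕ} (hf : ∀ i, f (i + 1) < f i ∨ f (i + 1) = 0) :
    ∃ lam : StrictPartition, lam.part = f := by
  have antitone_f : Antitone f := antitone_nat_of_succ_le fun i => by
    have := hf i
    omega
  have lt_of_lt {i j : ℕ} (hij : i < j) (hi : f i ≠ 0) : f j < f i := by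
    have := hf i
    have := antitone_f (show i + 1 ≤ j from hij)
    omega
  refine ⟨⟨f, antitone_f, fun i j hi hij => ?_⟩, rfl⟩
  rcases lt_trichotomy i j with h | h | h
  · exact absurd hij (lt_of_lt h hi).ne'
  · exact h
  · exact absurd hij (lt_of_lt h (hij ▸ hi)).ne

theorem isRowGraph : IsRowGraph Covers empty part cells id where
  row_injective := fun _ _ => StrictPartition.ext
  row_root := rfl
  row_antitone := antitone
  mem_cells := mem_cells _ _ _
  edge_iff := Iff.rfl

theorem exists_part_eq_add_single_iff {mu : StrictPartition} {i : ℕ} :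
    (∃ lam : StrictPartition, lam.part = mu.part + Finsupp.single i 1) ↔
      i = 0 ∨ mu.part i + 1 < mu.part (i - 1) := by
  constructor
  · rintro ⟨lam, hlam⟩
    have := lam.part_succ_lt (i - 1)
    have := lam.antitone (Nat.sub_le i 1)
    rw [hlam] at *
    simp only [Finsupp.add_apply, Finsupp.single_apply] at *
    grind
  · intro hi
    refine exists_part_eq fun j => ?_
    have := mu.part_succ_lt j
    have := mu.antitone (Nat.le_succ j)
    simp only [Finsupp.add_apply, Finsupp.single_apply]
    grind

theorem exists_add_single_eq_part_iff {lam : StrictPartition} {i : ℕ} :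
    (∃ mu : StrictPartition, lam.part = mu.part + Finsupp.single i 1) ↔
      lam.part i ≠ 0 ∧ (lam.part (i + 1) + 1 < lam.part i ∨ lam.part (i + 1) = 0) := by
  constructor
  · rintro ⟨mu, hmu⟩
    have := mu.part_succ_lt i
    have := mu.antitone (Nat.le_succ i)
    rw [hmu]
    simp only [Finsupp.add_apply, Finsupp.single_apply]
    grind
  · rintro ⟨hi, hi'⟩
    obtain ⟨mu, hmu⟩ := exists_part_eq (f := lam.part - Finsupp.single i 1) fun j => by
      have := lam.part_succ_lt j
      have := lam.antitone (Nat.le_succ j)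
      simp only [Finsupp.tsub_apply, Finsupp.single_apply]
      grind
    refine ⟨mu, ?_⟩
    rw [hmu, tsub_add_cancel_of_le (Finsupp.single_le_iff.2 (by omega))]

end StrictPartition

namespace YoungGraph

/-- The strictly decreasing numbers `ρ_j + k - 1 - j`, `j < k`, that enter Frobenius' formula. -/
noncomputable def beta (ρ : YoungDiagram) (k j : ℕ) : ℕ := rows ρ j + (k - 1 - j)

/-- Frobenius' formula for the number of standard tableaux, in terms of the first `k` rows; see
`dim_eq_frobeniusDim`. -/
noncomputable def frobeniusDim (k : ℕ) (ρ : YoungDiagram) : ℝ :=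
  (rows ρ).degree.factorial * pairQuotient (fun x y : ℕ => (x : ℝ) - y) k (beta ρ k)

theorem beta_lt_beta (ρ : YoungDiagram) {k i j : ℕ} (hji : j < i) (hi : i < k) :
    beta ρ k i < beta ρ k j := by
  have := rows_antitone ρ hji.le
  unfold beta
  omega

theorem beta_ne_beta (ρ : YoungDiagram) {k i j : ℕ} (hij : i ≠ j) (hi : i < k) (hj : j < k) :
    beta ρ k j ≠ beta ρ k i := by
  rcases hij.lt_or_gt with h | h
  · exact (beta_lt_beta ρ h hj).ne
  · exact (beta_lt_beta ρ h hi).ne'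

theorem beta_eq_update {σ ρ : YoungDiagram} {i : ℕ} (h : rows ρ = rows σ + Finsupp.single i 1)
    (k : ℕ) : beta ρ k = Function.update (beta σ k) i (beta σ k i + 1) := by
  ext j
  simp only [beta, h, Finsupp.add_apply, Finsupp.single_apply, Function.update_apply]
  grind

theorem frobeniusDim_succ {ρ : YoungDiagram} {k : ℕ} (hk : rows ρ k = 0) :
    frobeniusDim (k + 1) ρ = frobeniusDim k ρ := by
  have beta_succ (j : ℕ) (hj : j < k) : beta ρ (k + 1) j = beta ρ k j + 1 := by
    unfold beta
    omega
  have beta_last : beta ρ (k + 1) k = 0 := by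
    unfold beta
    omega
  have pairProd_shift : pairProd (fun x y : ℕ => (x : ℝ) - y) k (beta ρ (k + 1)) =
      pairProd (fun x y : ℕ => (x : ℝ) - y) k (beta ρ k) :=
    prod_congr rfl fun i hi => prod_congr rfl fun j hj => by
      rw [mem_range] at hi hj
      rw [beta_succ i hi, beta_succ j (hj.trans hi)]
      push_cast
      ring
  have prod_last_eq : ∏ j ∈ range k, ((beta ρ (k + 1) j : ℝ) - beta ρ (k + 1) k) =
      ∏ j ∈ range k, ((beta ρ k j : ℝ) + 1) := prod_congr rfl fun j hj => by
    rw [beta_succ j (mem_range.1 hj), beta_last, Nat.cast_succ, Nat.cast_zero, sub_zero]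
  have prod_factorial_eq : ∏ j ∈ range (k + 1), ((beta ρ (k + 1) j).factorial : ℝ) =
      (∏ j ∈ range k, ((beta ρ k j : ℝ) + 1)) * ∏ j ∈ range k, ((beta ρ k j).factorial : ℝ) := by
    rw [prod_range_succ, beta_last, Nat.factorial_zero, Nat.cast_one, mul_one, ← prod_mul_distrib]
    refine prod_congr rfl fun j hj => ?_
    rw [beta_succ j (mem_range.1 hj), Nat.factorial_succ, Nat.cast_mul, Nat.cast_succ]
  have prod_succ_ne_zero : ∏ j ∈ range k, ((beta ρ k j : ℝ) + 1) ≠ 0 :=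
    prod_ne_zero_iff.2 fun j _ => Nat.cast_add_one_ne_zero _
  rw [frobeniusDim, frobeniusDim, pairQuotient, pairQuotient, pairProd_succ, pairProd_shift,
    prod_last_eq, prod_factorial_eq, mul_comm (∏ j ∈ _, ((beta ρ k j : ℝ) + 1)),
    mul_div_mul_right _ _ prod_succ_ne_zero]

theorem frobeniusDim_eq_of_le {ρ : YoungDiagram} {k : ℕ} (hk : (rows ρ).support.card ≤ k) :
    frobeniusDim k ρ = frobeniusDim (rows ρ).support.card ρ := by
  induction k, hk using Nat.le_induction with
  | base => rfl
  | succ k hk ih => rw [frobeniusDim_succ (isRowGraph.row_eq_zero hk), ih]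

theorem frobeniusDim_mul_degree {σ ρ : YoungDiagram} {i k : ℕ}
    (h : rows ρ = rows σ + Finsupp.single i 1) (hi : i < k) :
    frobeniusDim k σ * (rows ρ).degree = frobeniusDim k ρ * (beta ρ k i *
      partialFractionCoeff (range k) (fun j => (beta ρ k j : ℝ)) (fun _ => 1) i) := by
  have beta_i : beta ρ k i = beta σ k i + 1 := by rw [beta_eq_update h, Function.update_self]
  have beta_j {j : ℕ} (hj : j ≠ i) : beta ρ k j = beta σ k j := by
    rw [beta_eq_update h, Function.update_of_ne hj]
  have denom_ne_zero {j : ℕ} (hj : j ∈ (range k).erase i) :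
      ((beta σ k i + 1 : ℕ) : ℝ) - beta σ k j ≠ 0 := by
    rw [mem_erase, mem_range] at hj
    rw [← beta_i, ← beta_j hj.1]
    exact sub_ne_zero.2 (Nat.cast_injective.ne (beta_ne_beta ρ hj.1 hj.2 hi))
  have pairQuotient_eq := pairQuotient_eq_update_succ_mul (h := fun x y : ℕ => (x : ℝ) - y)
    (l := beta σ k) (fun x y => (neg_sub (y : ℝ) x).symm) hi fun j => denom_ne_zero
  have prod_eq : ∏ j ∈ (range k).erase i, ((beta σ k i : ℝ) - beta σ k j) /
        (((beta σ k i + 1 : ℕ) : ℝ) - beta σ k j) =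
      partialFractionCoeff (range k) (fun j => (beta ρ k j : ℝ)) (fun _ => 1) i := by
    rw [partialFractionCoeff, one_mul]
    refine prod_congr rfl fun j hj => ?_
    have := denom_ne_zero hj
    rw [beta_i, beta_j (ne_of_mem_erase hj), one_sub_div this]
    push_cast
    ring
  rw [← beta_eq_update h, prod_eq, ← Nat.cast_add_one, ← beta_i] at pairQuotient_eq
  rw [frobeniusDim, frobeniusDim, pairQuotient_eq, h, map_add, Finsupp.degree_single,
    Nat.factorial_succ, Nat.cast_mul]
  ring

theorem two_mul_sum_beta {ρ : YoungDiagram} {k : ℕ} (hk : (rows ρ).support ⊆ range k) :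
    2 * ∑ j ∈ range k, (beta ρ k j : ℝ) = 2 * (rows ρ).degree + (k ^ 2 - k) := by
  have sum_beta : ∑ j ∈ range k, beta ρ k j = (rows ρ).degree + ∑ j ∈ range k, j := by
    simp only [beta]
    rw [sum_add_distrib, sum_range_reflect (fun j => j), Finsupp.degree_apply,
      sum_subset hk fun i _ hi => Finsupp.notMem_support_iff.1 hi]
  have sum_range_cast (k : ℕ) : 2 * ∑ j ∈ range k, (j : ℝ) = k ^ 2 - k := by
    induction k with
    | zero => simp
    | succ k ih => rw [sum_range_succ, mul_add, ih, Nat.cast_succ]; ring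
  rw [← Nat.cast_sum, sum_beta, Nat.cast_add, Nat.cast_sum, mul_add, sum_range_cast]

theorem sum_beta_mul_partialFractionCoeff {ρ : YoungDiagram} {k : ℕ}
    (hk : (rows ρ).support ⊆ range k) :
    ∑ i ∈ range k, beta ρ k i *
      partialFractionCoeff (range k) (fun j => (beta ρ k j : ℝ)) (fun _ => 1) i =
        (rows ρ).degree := by
  have injOn_beta : Set.InjOn (fun j => (beta ρ k j : ℝ)) (range k) := fun i hi j hj hij => by
    by_contra hne
    exact beta_ne_beta ρ hne (mem_range.1 hi) (mem_range.1 hj) (Nat.cast_injective hij.symm)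
  have moment := two_mul_sum_mul_partialFractionCoeff (fun _ => (1 : ℝ)) injOn_beta
  simp only [mul_one, one_pow, sum_const, card_range, nsmul_eq_mul] at moment
  linear_combination (1 / 2) * moment + (1 / 2) * two_mul_sum_beta hk

theorem rows_succ_lt_of_partialFractionCoeff_ne_zero {ρ : YoungDiagram} {i : ℕ}
    (hi : i ∈ (rows ρ).support) (hne : partialFractionCoeff (range (rows ρ).support.card)
      (fun j => (beta ρ (rows ρ).support.card j : ℝ)) (fun _ => 1) i ≠ 0) :
    rows ρ (i + 1) < rows ρ i := by
  by_contra! hle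
  have rows_eq : rows ρ (i + 1) = rows ρ i := le_antisymm (rows_antitone ρ i.le_succ) hle
  have hi' : i + 1 < (rows ρ).support.card := by
    rw [← isRowGraph.mem_support_iff, Finsupp.mem_support_iff, rows_eq]
    exact Finsupp.mem_support_iff.1 hi
  have beta_eq : beta ρ (rows ρ).support.card i = beta ρ (rows ρ).support.card (i + 1) + 1 := by
    unfold beta
    omega
  refine hne (mul_eq_zero_of_right _ (prod_eq_zero (i := i + 1) ?_ ?_))
  · simpa using hi'
  · simp [beta_eq]

theorem dim_eq_frobeniusDim {ρ : YoungDiagram} {k : ℕ} (hk : (rows ρ).support.card ≤ k) :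
    (ρ.dim : ℝ) = frobeniusDim k ρ := by
  rw [frobeniusDim_eq_of_le hk]
  refine isRowGraph.numPaths_eq (F := fun ρ => frobeniusDim (rows ρ).support.card ρ) ?_
    (fun ρ i => beta ρ (rows ρ).support.card i * partialFractionCoeff (range (rows ρ).support.card)
      (fun j => (beta ρ (rows ρ).support.card j : ℝ)) (fun _ => 1) i) ?_ ?_ ?_ ρ
  · simp [isRowGraph.row_root, frobeniusDim, pairQuotient, pairProd]
  · intro σ ρ i h
    rw [← frobeniusDim_eq_of_le (IsRowGraph.card_support_le h),
      frobeniusDim_mul_degree h (isRowGraph.lt_card_support h)]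
  · intro ρ i hi hne
    exact exists_add_single_eq_rows_iff.2
      (rows_succ_lt_of_partialFractionCoeff_ne_zero hi (right_ne_zero_of_mul hne))
  · intro ρ
    have support_eq := antitone_support_eq_range_card (rows_antitone ρ)
    rw [support_eq, card_range]
    exact sum_beta_mul_partialFractionCoeff support_eq.subset

end YoungGraph

namespace StrictPartition

variable {mu lam : StrictPartition} {i j : ℕ}

theorem part_ne_zero_iff : lam.part i ≠ 0 ↔ i < lam.length := by
  rw [← Finsupp.mem_support_iff, isRowGraph.mem_support_iff, length]

theorem part_length (lam : StrictPartition) : lam.part lam.length = 0 :=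
  isRowGraph.row_eq_zero le_rfl

theorem le_length (h : lam.part = mu.part + Finsupp.single i 1) : i ≤ mu.length :=
  isRowGraph.le_card_support h

theorem length_le_length (h : lam.part = mu.part + Finsupp.single i 1) : mu.length ≤ lam.length :=
  IsRowGraph.card_support_le h

theorem length_le_length_succ (h : lam.part = mu.part + Finsupp.single i 1) :
    lam.length ≤ mu.length + 1 :=
  IsRowGraph.card_support_le_succ h

theorem length_of_part_ne_zero (h : lam.part = mu.part + Finsupp.single i 1)
    (hi : mu.part i ≠ 0) : lam.length = mu.length := by
  rw [length, length]
  congr 1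
  ext j
  simp only [h, Finsupp.mem_support_iff, Finsupp.add_apply, Finsupp.single_apply]
  grind

theorem length_of_part_eq_zero (h : lam.part = mu.part + Finsupp.single i 1)
    (hi : mu.part i = 0) : i = mu.length ∧ lam.length = mu.length + 1 := by
  have i_eq : i = mu.length := (le_length h).antisymm
    (not_lt.1 fun hlt => part_ne_zero_iff.2 hlt hi)
  refine ⟨i_eq, ?_⟩
  have i_notMem : i ∉ mu.part.support := Finsupp.notMem_support_iff.2 hi
  rw [length, length, ← card_insert_of_notMem i_notMem]
  congr 1
  ext j
  simp only [h, Finsupp.mem_support_iff, Finsupp.add_apply, Finsupp.single_apply, mem_insert]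
  grind

/-- The factor `(x - y) / (x + y)` of Schur's formula. -/
noncomputable def schurFactor (x y : ℕ) : ℝ := ((x : ℝ) - y) / (x + y)

theorem schurFactor_antisymm (x y : ℕ) : schurFactor x y = -schurFactor y x := by
  rw [schurFactor, schurFactor, ← neg_div, neg_sub, add_comm]

theorem schurFactor_ne_zero {x y : ℕ} (hxy : x ≠ y) : schurFactor x y ≠ 0 :=
  div_ne_zero (sub_ne_zero.2 (Nat.cast_injective.ne hxy)) (by norm_cast; omega)

/-- Schur's formula for the number of shifted standard tableaux; see `dim_eq_schurDim`. -/
noncomputable def schurDim (lam : StrictPartition) : ℝ :=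
  lam.weight.factorial * pairQuotient schurFactor lam.length lam.part

theorem pairQuotient_length_succ (lam : StrictPartition) :
    pairQuotient schurFactor (lam.length + 1) lam.part =
      pairQuotient schurFactor lam.length lam.part := by
  have prod_last : ∏ j ∈ range lam.length, schurFactor (lam.part j) (lam.part lam.length) = 1 :=
    prod_eq_one fun j hj => by
      have := part_ne_zero_iff.2 (mem_range.1 hj)
      rw [part_length, schurFactor, Nat.cast_zero, sub_zero, add_zero,
        div_self (Nat.cast_ne_zero.2 this)]
  rw [pairQuotient, pairQuotient, pairProd_succ, prod_last, prod_range_succ, part_length,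
    Nat.factorial_zero, Nat.cast_one, mul_one, mul_one]

-- For larger `k` the left-hand side vanishes, since `schurFactor 0 0 = 0`.
theorem pairQuotient_part {k : ℕ} (hk : lam.length ≤ k) (hk' : k ≤ lam.length + 1) :
    pairQuotient schurFactor k lam.part = pairQuotient schurFactor lam.length lam.part := by
  obtain rfl | rfl : k = lam.length ∨ k = lam.length + 1 := by omega
  · rfl
  · exact pairQuotient_length_succ lam

theorem part_eq_update (h : lam.part = mu.part + Finsupp.single i 1) :
    ⇑lam.part = Function.update mu.part i (mu.part i + 1) := by
  ext j
  simp only [h, Finsupp.add_apply, Finsupp.single_apply, Function.update_apply]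
  grind

theorem part_ne_part (hij : i ≠ j) (hi : i < lam.length) : lam.part i ≠ lam.part j :=
  fun h => hij (lam.strict i j (part_ne_zero_iff.2 hi) h)

theorem part_ne_part_of_le (hij : i ≠ j) (hi : i ≤ lam.length) (hj : j ≤ lam.length) :
    lam.part i ≠ lam.part j := by
  rcases hi.lt_or_eq with hi | rfl
  · exact part_ne_part hij hi
  · exact (part_ne_part hij.symm (hj.lt_of_ne hij.symm)).symm

theorem schurFactor_pred_div {p q : ℕ} (hpq : p + 1 ≠ q) (hq : q ≠ 0) :
    schurFactor p q / schurFactor (p + 1) q =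
      1 - 2 * q / (((p + 1 : ℕ) : ℝ) * ((p + 1 : ℕ) - 1) - q * (q - 1)) := by
  have succ_sub_ne_zero : (p : ℝ) + 1 - q ≠ 0 := sub_ne_zero.2 (by exact_mod_cast hpq)
  have add_ne_zero : (p : ℝ) + q ≠ 0 := by norm_cast; omega
  have denom_eq : ((p : ℝ) + 1) * (p + 1 - 1) - q * (q - 1) = (p + 1 - q) * (p + q) := by ring
  simp only [schurFactor, Nat.cast_succ]
  rw [denom_eq]
  field_simp
  ring

theorem schurDim_mul_weight (h : lam.part = mu.part + Finsupp.single i 1) :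
    schurDim mu * lam.weight = schurDim lam *
      (partialFractionCoeff (range lam.length) (fun j => (lam.part j : ℝ) * (lam.part j - 1))
        (fun j => 2 * (lam.part j : ℝ)) i / 2) := by
  have hi : i < lam.length := isRowGraph.lt_card_support h
  have part_i : lam.part i = mu.part i + 1 := by simp [h]
  have part_j {j : ℕ} (hj : j ∈ (range lam.length).erase i) :
      lam.part j = mu.part j ∧ mu.part i + 1 ≠ lam.part j ∧ lam.part j ≠ 0 := by
    rw [mem_erase, mem_range] at hj
    rw [← part_i]
    exact ⟨by simp [h, Ne.symm hj.1], part_ne_part (Ne.symm hj.1) hi,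
      part_ne_zero_iff.2 hj.2⟩
  have pairQuotient_eq := pairQuotient_eq_update_succ_mul (l := mu.part) schurFactor_antisymm hi
    fun j hj => schurFactor_ne_zero ((part_j hj).1 ▸ (part_j hj).2.1)
  have prod_eq : ∏ j ∈ (range lam.length).erase i,
        schurFactor (mu.part i) (mu.part j) / schurFactor (mu.part i + 1) (mu.part j) =
      ∏ j ∈ (range lam.length).erase i, (1 - 2 * (lam.part j : ℝ) /
        (lam.part i * (lam.part i - 1) - lam.part j * (lam.part j - 1))) :=
    prod_congr rfl fun j hj => by
      obtain ⟨part_eq, hne, hne_zero⟩ := part_j hj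
      rw [← part_eq, schurFactor_pred_div hne hne_zero, ← part_i]
  have weight_eq : lam.weight = mu.weight + 1 := (isRowGraph.edge_iff.1
    (isRowGraph.edge_iff_exists.2 ⟨i, h⟩)).2
  rw [← part_eq_update h, prod_eq] at pairQuotient_eq
  rw [schurDim, schurDim, ← pairQuotient_part (length_le_length h)
    (length_le_length_succ h), pairQuotient_eq, weight_eq, Nat.factorial_succ,
    partialFractionCoeff, part_i]
  push_cast
  ring

theorem sum_partialFractionCoeff_part (lam : StrictPartition) :
    ∑ i ∈ range lam.length, partialFractionCoeff (range lam.length)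
      (fun j => (lam.part j : ℝ) * (lam.part j - 1)) (fun j => 2 * (lam.part j : ℝ)) i / 2 =
        lam.weight := by
  have injOn : Set.InjOn (fun j => (lam.part j : ℝ) * (lam.part j - 1)) (range lam.length) := by
    intro i hi j hj hij
    have hi' := part_ne_zero_iff.2 (mem_range.1 hi)
    have hj' := part_ne_zero_iff.2 (mem_range.1 hj)
    by_contra hne
    have part_sub_ne_zero : (lam.part i : ℝ) - lam.part j ≠ 0 :=
      sub_ne_zero.2 (Nat.cast_injective.ne (part_ne_part hne (mem_range.1 hi)))
    have add_sub_ne_zero : (lam.part i : ℝ) + lam.part j - 1 ≠ 0 :=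
      sub_ne_zero.2 (by norm_cast; omega)
    refine mul_ne_zero part_sub_ne_zero add_sub_ne_zero ?_
    linear_combination hij
  rw [← sum_div, sum_partialFractionCoeff _ injOn, ← mul_sum, mul_div_cancel_left₀ _ two_ne_zero,
    weight, Nat.cast_sum, antitone_support_eq_range_card lam.antitone, length]

theorem part_succ_lt_of_partialFractionCoeff_ne_zero (hi : lam.part i ≠ 0)
    (hne : partialFractionCoeff (range lam.length) (fun j => (lam.part j : ℝ) * (lam.part j - 1))
      (fun j => 2 * (lam.part j : ℝ)) i ≠ 0) :
    lam.part (i + 1) + 1 < lam.part i ∨ lam.part (i + 1) = 0 := by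
  by_contra! hle
  have part_eq : lam.part i = lam.part (i + 1) + 1 := by
    have := lam.part_succ_lt i hi
    omega
  have part_succ_ne_zero : (lam.part (i + 1) : ℝ) ≠ 0 := Nat.cast_ne_zero.2 hle.2
  refine hne (mul_eq_zero_of_right _ (prod_eq_zero (i := i + 1) ?_ ?_))
  · simpa using part_ne_zero_iff.1 hle.2
  · have denom_eq : ((lam.part (i + 1) : ℝ) + 1) * (lam.part (i + 1) + 1 - 1) -
        lam.part (i + 1) * (lam.part (i + 1) - 1) = 2 * lam.part (i + 1) := by ring
    simp only [part_eq, Nat.cast_succ, denom_eq]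
    rw [div_self (mul_ne_zero two_ne_zero part_succ_ne_zero), sub_self]

theorem dim_eq_schurDim (lam : StrictPartition) : (lam.dim : ℝ) = schurDim lam := by
  refine isRowGraph.numPaths_eq (F := schurDim) ?_
    (fun lam i => partialFractionCoeff (range lam.length)
      (fun j => (lam.part j : ℝ) * (lam.part j - 1)) (fun j => 2 * (lam.part j : ℝ)) i / 2)
    schurDim_mul_weight ?_ ?_ lam
  · simp [empty, weight, length, schurDim, pairQuotient, pairProd]
  · intro lam i hi hne
    rw [Finsupp.mem_support_iff] at hi
    exact exists_add_single_eq_part_iff.2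
      ⟨hi, part_succ_lt_of_partialFractionCoeff_ne_zero hi (div_ne_zero_iff.1 hne).1⟩
  · intro lam
    rw [antitone_support_eq_range_card lam.antitone]
    exact sum_partialFractionCoeff_part lam

end StrictPartition

theorem upProb_eq_of_edge {V : Type} {E : V → V → Prop} {root u v : V} {M w m : V → ℝ}
    (hM : ∀ v, M v = w v * (numPaths E root v : ℝ) ^ 2 / m v) (huv : E u v) :
    upProb E root M u v =
      w v / w u * ((numPaths E root v / m v) / (numPaths E root u / m u)) := by
  rw [upProb, if_pos huv, downProb, if_pos huv, hM, hM]
  by_cases hu : (numPaths E root u : ℝ) = 0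
  · simp [hu]
  by_cases hv : (numPaths E root v : ℝ) = 0
  · simp [hv]
  field_simp

namespace YoungGraph

variable {σ ρ : YoungDiagram} {i j : ℕ}

/-- The content of the box that follows the last box of row `i`. -/
noncomputable def rowContent (ρ : YoungDiagram) (i : ℕ) : ℤ := (rows ρ i : ℤ) - i

theorem rowContent_ne (hij : i ≠ j) : rowContent ρ i ≠ rowContent ρ j := by
  unfold rowContent
  rcases hij.lt_or_gt with h | h <;> have := rows_antitone ρ h.le <;> omega

theorem beta_sub_beta (ρ : YoungDiagram) {k : ℕ} (hi : i < k) (hj : j < k) :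
    (beta ρ k i : ℝ) - beta ρ k j = rowContent ρ i - rowContent ρ j := by
  have beta_eq {i : ℕ} (hi : i < k) : (beta ρ k i : ℤ) = rowContent ρ i + k - 1 := by
    unfold beta rowContent
    omega
  exact_mod_cast (by rw [beta_eq hi, beta_eq hj]; ring :
    (beta ρ k i : ℤ) - beta ρ k j = rowContent ρ i - rowContent ρ j)

theorem plancherelUp_eq_pairQuotient (h : rows ρ = rows σ + Finsupp.single i 1) {k : ℕ}
    (hk : (rows ρ).support.card ≤ k) : σ.plancherelUp ρ =
      pairQuotient (fun x y : ℕ => (x : ℝ) - y) k (beta ρ k) /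
        pairQuotient (fun x y : ℕ => (x : ℝ) - y) k (beta σ k) := by
  have dim_div_factorial {τ : YoungDiagram} (hτ : (rows τ).support.card ≤ k) :
      (τ.dim : ℝ) / τ.card.factorial =
        pairQuotient (fun x y : ℕ => (x : ℝ) - y) k (beta τ k) := by
    rw [dim_eq_frobeniusDim hτ, frobeniusDim, card_eq_degree_rows,
      mul_div_cancel_left₀ _ (Nat.cast_ne_zero.2 (Nat.factorial_ne_zero _))]
  have plancherel_eq (τ : YoungDiagram) :
      τ.plancherel = 1 * (τ.dim : ℝ) ^ 2 / τ.card.factorial := by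
    rw [one_mul, YoungDiagram.plancherel]
  rw [← dim_div_factorial hk, ← dim_div_factorial ((IsRowGraph.card_support_le h).trans hk),
    YoungDiagram.plancherelUp,
    upProb_eq_of_edge plancherel_eq (isRowGraph.edge_iff_exists.2 ⟨i, h⟩), div_one, one_mul]
  rfl

theorem plancherelUp_eq (h : rows ρ = rows σ + Finsupp.single i 1) : σ.plancherelUp ρ =
    (∏ j ∈ range (rows σ).support.card, (rowContent σ i - (rowContent σ j - 1) : ℝ)) /
      ∏ j ∈ (range ((rows σ).support.card + 1)).erase i,
        (rowContent σ i - rowContent σ j : ℝ) := by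
  set k := (rows σ).support.card + 1 with hk
  have hi : i < k := Nat.lt_succ_of_le (isRowGraph.le_card_support h)
  have beta_sub {j : ℕ} (hj : j ∈ (range k).erase i) :
      (beta σ k i : ℝ) - beta σ k j = rowContent σ i - rowContent σ j :=
    beta_sub_beta σ hi (mem_range.1 (mem_of_mem_erase hj))
  have succ_beta_eq : (beta σ k i : ℝ) + 1 = rowContent σ i - (rowContent σ (k - 1) - 1) := by
    have beta_last : beta σ k (k - 1) = 0 := by
      have row_last : rows σ (k - 1) = 0 := isRowGraph.row_eq_zero le_rfl
      rw [beta, row_last, Nat.sub_self]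
    have := beta_sub_beta σ hi (Nat.lt_succ_self _ : k - 1 < k)
    rw [beta_last, Nat.cast_zero] at this
    linear_combination this
  have prod_mul : (∏ j ∈ range (k - 1), (rowContent σ i - (rowContent σ j - 1) : ℝ)) *
        (beta σ k i + 1) =
      ∏ j ∈ (range k).erase i, (rowContent σ i - (rowContent σ j - 1) : ℝ) := by
    rw [succ_beta_eq, hk, Nat.add_sub_cancel, ← prod_range_succ, ← hk,
      ← mul_prod_erase _ _ (mem_range.2 hi), sub_sub_cancel, one_mul]
  rw [plancherelUp_eq_pairQuotient h (IsRowGraph.card_support_le_succ h),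
    beta_eq_update h, pairQuotient_update_succ_div (fun x y => (neg_sub (y : ℝ) x).symm) hi
      fun i j hij hi hj => sub_ne_zero.2 (Nat.cast_injective.ne (beta_ne_beta σ hij hi hj))]
  have prod_eq : ∏ j ∈ (range k).erase i, (((beta σ k i + 1 : ℕ) : ℝ) - beta σ k j) /
        (beta σ k i - beta σ k j) = ∏ j ∈ (range k).erase i,
        (rowContent σ i - (rowContent σ j - 1) : ℝ) / (rowContent σ i - rowContent σ j) :=
    prod_congr rfl fun j hj => by
      rw [Nat.cast_succ, ← beta_sub hj]
      congr 1
      linear_combination beta_sub hj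
  rw [prod_eq, prod_div_distrib, ← prod_mul, div_right_comm,
    mul_div_cancel_right₀ _ (Nat.cast_add_one_ne_zero _)]
  rfl

end YoungGraph

namespace StrictPartition

variable {mu lam : StrictPartition} {i : ℕ}

theorem plancherelUp_eq_pairQuotient (h : lam.part = mu.part + Finsupp.single i 1) :
    mu.plancherelUp lam = (2 : ℝ) ^ (1 + mu.length - lam.length : ℤ) *
      (pairQuotient schurFactor (mu.length + 1) lam.part /
        pairQuotient schurFactor (mu.length + 1) mu.part) := by
  have dim_div_factorial (nu : StrictPartition) : (nu.dim : ℝ) / nu.weight.factorial =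
      pairQuotient schurFactor nu.length nu.part := by
    rw [dim_eq_schurDim, schurDim,
      mul_div_cancel_left₀ _ (Nat.cast_ne_zero.2 (Nat.factorial_ne_zero _))]
  have edge : mu.Covers lam := isRowGraph.edge_iff_exists.2 ⟨i, h⟩
  have exponent_eq : (1 + mu.length - lam.length : ℤ) =
      (lam.weight - lam.length) - (mu.weight - mu.length) := by
    rw [edge.2]
    push_cast
    ring
  rw [plancherelUp, upProb_eq_of_edge (M := plancherel) (fun _ => rfl) edge, exponent_eq,
    zpow_sub₀ two_ne_zero (lam.weight - lam.length : ℤ),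
    pairQuotient_part (length_le_length_succ h) (Nat.succ_le_succ (length_le_length h)),
    pairQuotient_part (Nat.le_succ _) le_rfl, ← dim_div_factorial, ← dim_div_factorial]
  rfl

theorem schurFactor_succ_div {p q : ℕ} (hpq : p ≠ q) :
    schurFactor (p + 1) q / schurFactor p q =
      ((p : ℝ) * (p + 1) - q * (q - 1)) / (p * (p + 1) - q * (q + 1)) := by
  have p_sub_q_ne_zero : (p : ℝ) - q ≠ 0 := sub_ne_zero.2 (Nat.cast_injective.ne hpq)
  have denom_eq : (p : ℝ) * (p + 1) - q * (q + 1) = (p - q) * (p + 1 + q) := by ring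
  simp only [schurFactor, Nat.cast_succ]
  rw [denom_eq]
  field_simp
  ring

theorem two_zpow_mul_prod_erase (h : lam.part = mu.part + Finsupp.single i 1) {v : ℝ}
    (hv : v = mu.part i * (mu.part i + 1)) :
    (2 : ℝ) ^ (1 + mu.length - lam.length : ℤ) *
        ∏ j ∈ (range (mu.length + 1)).erase i, (v - mu.part j * (mu.part j - 1)) =
      (∏ j ∈ range mu.length, (v - mu.part j * (mu.part j - 1))) * (mu.part i + 1) := by
  by_cases hi : mu.part i = 0
  · obtain ⟨rfl, length_eq⟩ := length_of_part_eq_zero h hi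
    rw [length_eq, range_add_one, erase_insert notMem_range_self, hi]
    simp [add_comm]
  · have prod_mul : (∏ j ∈ range mu.length, (v - mu.part j * (mu.part j - 1))) * v =
        (2 * mu.part i) *
          ∏ j ∈ (range (mu.length + 1)).erase i, (v - mu.part j * (mu.part j - 1)) := by
      have factor_last : v = v - mu.part mu.length * (mu.part mu.length - 1) := by
        rw [part_length, Nat.cast_zero, zero_mul, sub_zero]
      nth_rw 2 [factor_last]
      rw [← prod_range_succ, ← mul_prod_erase _ _
        (mem_range.2 (Nat.lt_succ_of_le (le_length h))), hv]
      ring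
    rw [length_of_part_ne_zero h hi, add_sub_cancel_right, zpow_one]
    refine mul_left_cancel₀ (Nat.cast_ne_zero.2 hi : (mu.part i : ℝ) ≠ 0) ?_
    rw [hv] at prod_mul ⊢
    linear_combination -prod_mul

theorem plancherelUp_eq (h : lam.part = mu.part + Finsupp.single i 1) {v : ℝ}
    (hv : v = mu.part i * (mu.part i + 1)) : mu.plancherelUp lam =
    (∏ j ∈ range mu.length, (v - mu.part j * (mu.part j - 1))) /
      ∏ j ∈ (range (mu.length + 1)).erase i, (v - mu.part j * (mu.part j + 1)) := by
  have hi : i < mu.length + 1 := Nat.lt_succ_of_le (le_length h)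
  have part_ne {j k : ℕ} (hjk : j ≠ k) (hj : j < mu.length + 1) (hk : k < mu.length + 1) :
      mu.part j ≠ mu.part k :=
    part_ne_part_of_le hjk (Nat.le_of_lt_succ hj) (Nat.le_of_lt_succ hk)
  have prod_eq : ∏ j ∈ (range (mu.length + 1)).erase i,
        schurFactor (mu.part i + 1) (mu.part j) / schurFactor (mu.part i) (mu.part j) =
      ∏ j ∈ (range (mu.length + 1)).erase i,
        (v - mu.part j * (mu.part j - 1)) / (v - mu.part j * (mu.part j + 1)) :=
    prod_congr rfl fun j hj => by
      rw [mem_erase, mem_range] at hj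
      rw [schurFactor_succ_div (part_ne (Ne.symm hj.1) hi hj.2), hv]
  rw [plancherelUp_eq_pairQuotient h, part_eq_update h,
    pairQuotient_update_succ_div schurFactor_antisymm hi
      fun i j hij hi hj => schurFactor_ne_zero (part_ne hij.symm hj hi),
    prod_eq, prod_div_distrib, mul_div_assoc', mul_div_assoc', two_zpow_mul_prod_erase h hv,
    div_right_comm, mul_div_cancel_right₀ _ (Nat.cast_add_one_ne_zero _)]

end StrictPartition

/-- `f` has residue `r` at `c`, in the sense of an at most simple pole: `(z - c) f(z) → r` as
`z → c`. -/
def HasResidueAt {𝕜 : Type*} [NontriviallyNormedField 𝕜] (f : 𝕜 → 𝕜) (c r : 𝕜) : Prop :=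
  Tendsto (fun z => (z - c) * f z) (𝓝[≠] c) (𝓝 r)

namespace HasResidueAt

variable {𝕜 : Type*} [NontriviallyNormedField 𝕜] {f g : 𝕜 → 𝕜} {c r s : 𝕜}

theorem unique (hr : HasResidueAt f c r) (hs : HasResidueAt f c s) : r = s :=
  tendsto_nhds_unique hr hs

theorem congr' (hf : HasResidueAt f c r) (hfg : f =ᶠ[𝓝[≠] c] g) : HasResidueAt g c r :=
  Tendsto.congr' (hfg.mono fun z hz => by rw [hz]) hf

theorem mul_continuousAt (hf : HasResidueAt f c r) (hg : ContinuousAt g c) :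
    HasResidueAt (fun z => f z * g z) c (r * g c) := by
  simpa only [HasResidueAt, mul_assoc] using
    Tendsto.mul hf (hg.tendsto.mono_left nhdsWithin_le_nhds)

theorem comp {φ : 𝕜 → 𝕜} (hf : HasResidueAt f (φ c) r)
    (hφ : ∀ z, φ z - φ c = (z - c) * g z) (hg : ContinuousAt g c) (hgc : g c ≠ 0) :
    HasResidueAt (fun z => f (φ z)) c (r / g c) := by
  have g_ne_zero : ∀ᶠ z in 𝓝[≠] c, g z ≠ 0 := nhdsWithin_le_nhds (hg.eventually_ne hgc)
  have φ_tendsto : Tendsto φ (𝓝[≠] c) (𝓝[≠] φ c) := by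
    refine tendsto_nhdsWithin_iff.2 ⟨?_, ?_⟩
    · have : ContinuousAt (fun z => φ c + (z - c) * g z) c := by fun_prop
      simp only [← hφ, add_sub_cancel] at this
      exact this.tendsto.mono_left nhdsWithin_le_nhds
    · filter_upwards [self_mem_nhdsWithin, g_ne_zero] with z hz hgz
      exact sub_ne_zero.1 (hφ z ▸ mul_ne_zero (sub_ne_zero.2 hz) hgz)
  refine ((Tendsto.comp hf φ_tendsto).div (hg.tendsto.mono_left nhdsWithin_le_nhds) hgc).congr' ?_
  filter_upwards [g_ne_zero] with z hgz
  simp only [Function.comp_apply, Pi.div_apply]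
  rw [hφ, mul_right_comm, mul_div_cancel_right₀ _ hgz]

theorem of_prod_div_prod {ι : Type*} [DecidableEq ι] {s t : Finset ι} {a x : ι → 𝕜} {i : ι}
    (hi : i ∈ t) (hx : ∀ j ∈ t.erase i, x i ≠ x j) :
    HasResidueAt (fun z => (∏ j ∈ s, (z - a j)) / ∏ j ∈ t, (z - x j)) (x i)
      ((∏ j ∈ s, (x i - a j)) / ∏ j ∈ t.erase i, (x i - x j)) := by
  have quotient_continuousAt :
      ContinuousAt (fun z => (∏ j ∈ s, (z - a j)) / ∏ j ∈ t.erase i, (z - x j)) (x i) :=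
    ContinuousAt.div (by fun_prop) (by fun_prop)
      (prod_ne_zero_iff.2 fun j hj => sub_ne_zero.2 (hx j hj))
  refine (quotient_continuousAt.tendsto.mono_left nhdsWithin_le_nhds).congr' ?_
  filter_upwards [self_mem_nhdsWithin] with z hz
  rw [← mul_prod_erase t _ hi, mul_div_assoc', mul_div_mul_left _ _ (sub_ne_zero.2 hz)]

end HasResidueAt

namespace YoungGraph

/-- The rational function `∏ (z - (c_i - 1)) / ∏ (z - c_i)` of a diagram with row contents `c_i`,
the product on top ranging over the nonempty rows and the one below over one row more. The
contents of the boxes at the corners are what remains after cancellation. -/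
noncomputable def rowRatio {K : Type*} [Field K] (ρ : YoungDiagram) (z : K) : K :=
  (∏ i ∈ range (rows ρ).support.card, (z - ((rowContent ρ i : K) - 1))) /
    ∏ i ∈ range ((rows ρ).support.card + 1), (z - (rowContent ρ i : K))

theorem hasResidueAt_rowRatio {σ ρ : YoungDiagram} {i : ℕ}
    (h : rows ρ = rows σ + Finsupp.single i 1) :
    HasResidueAt (rowRatio σ : ℝ → ℝ) (rowContent σ i) (σ.plancherelUp ρ) := by
  rw [plancherelUp_eq h]
  exact .of_prod_div_prod (a := fun j => (rowContent σ j : ℝ) - 1)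
    (x := fun j => (rowContent σ j : ℝ))
    (mem_range.2 (Nat.lt_succ_of_le (isRowGraph.le_card_support h)))
    fun j hj => Int.cast_injective.ne (rowContent_ne (ne_of_mem_erase hj).symm)

end YoungGraph

namespace StrictPartition

/-- The analogue of `YoungGraph.rowRatio` for a strict partition with parts `p_i`, where row `i`
contributes `p_i (p_i - 1)` on top and `p_i (p_i + 1)` below. -/
noncomputable def rowRatio {K : Type*} [Field K] (lam : StrictPartition) (v : K) : K :=
  (∏ i ∈ range lam.length, (v - lam.part i * (lam.part i - 1))) /
    ∏ i ∈ range (lam.length + 1), (v - lam.part i * (lam.part i + 1))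

theorem hasResidueAt_rowRatio {mu lam : StrictPartition} {i : ℕ}
    (h : lam.part = mu.part + Finsupp.single i 1) :
    HasResidueAt (rowRatio mu : ℝ → ℝ) (mu.part i * (mu.part i + 1)) (mu.plancherelUp lam) := by
  rw [plancherelUp_eq h rfl]
  refine .of_prod_div_prod (a := fun j => (mu.part j : ℝ) * (mu.part j - 1))
    (x := fun j => (mu.part j : ℝ) * (mu.part j + 1))
    (mem_range.2 (Nat.lt_succ_of_le (le_length h))) fun j hj => ?_
  rw [mem_erase, mem_range] at hj
  have part_ne := part_ne_part_of_le (Ne.symm hj.1) (le_length h) (Nat.le_of_lt_succ hj.2)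
  have mul_succ_strictMono : StrictMono fun p : ℕ => p * (p + 1) :=
    fun p q hpq => Nat.mul_lt_mul_of_lt_of_lt hpq (Nat.succ_lt_succ hpq)
  exact_mod_cast mul_succ_strictMono.injective.ne part_ne

end StrictPartition

section ContentFactor

variable {K : Type*} [Field K] {z : K}

theorem prod_range_div_succ {g : ℕ → K} (hg : ∀ j, g j ≠ 0) (n : ℕ) :
    ∏ j ∈ range n, g j / g (j + 1) = g 0 / g n := by
  induction n with
  | zero => simp [hg]
  | succ n ih => rw [prod_range_succ, ih, div_mul_div_cancel₀ (hg n)]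

theorem prod_range_sq_div {g : ℕ → K} (hg : ∀ j, g j ≠ 0) (n : ℕ) :
    ∏ j ∈ range n, g (j + 1) ^ 2 / (g j * g (j + 2)) = g 1 / g 0 * (g n / g (n + 1)) := by
  have := prod_range_div_succ (g := fun j => g (j + 1) / g j)
    (fun j => div_ne_zero (hg _) (hg _)) n
  rw [div_div_eq_mul_div, zero_add] at this
  rw [← mul_div_assoc, ← this]
  refine prod_congr rfl fun j _ => ?_
  rw [div_div_div_eq, sq]

/-- The factor `(z - c)² / ((z - c - 1) (z - c + 1))` by which a box of content `c` changes
`z · rowRatio ρ z` when it is added to a diagram `ρ`. -/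
def contentFactor (z c : K) : K :=
  (z - c) ^ 2 / ((z - c - 1) * (z - c + 1))

theorem prod_contentFactor_row (hz : ∀ n : ℤ, z ≠ n) (i m : ℕ) :
    ∏ j ∈ range m, contentFactor z (j - i) =
      (z + i) / (z + (i + 1 : ℕ)) * ((z - (m - i - 1)) / (z - (m - i))) := by
  set g : ℕ → K := fun j => z - j + (i + 1 : ℕ) with hg
  have g_ne_zero (j : ℕ) : g j ≠ 0 := fun h =>
    hz (j - i - 1) (by simp only [hg] at h; push_cast at h ⊢; linear_combination h)
  convert prod_range_sq_div g_ne_zero m using 2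
  · rw [contentFactor]
    simp only [hg]
    push_cast
    ring_nf
  all_goals
    simp only [hg]
    push_cast
    ring_nf

theorem prod_contentFactor_shiftedRow (hz : ∀ n : ℤ, z ≠ n) (m : ℕ) :
    ∏ j ∈ range m, contentFactor z (j + 1) * contentFactor z (-j) =
      (z * (z - 1) - m * (m - 1)) / (z * (z - 1) - m * (m + 1)) := by
  set g : ℕ → K := fun j => z * (z - 1) - j * (j - 1) with hg
  have g_eq (j : ℕ) : g j = (z - j) * (z + j - 1) := by
    simp only [hg]
    ring
  have g_ne_zero (j : ℕ) : g j ≠ 0 := by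
    refine g_eq j ▸ mul_ne_zero (fun h => hz j ?_) fun h => hz (1 - j) ?_ <;> push_cast <;>
      linear_combination h
  convert prod_range_sq_div g_ne_zero m using 2 with j
  · rw [contentFactor, contentFactor, div_mul_div_comm, g_eq, g_eq, g_eq]
    push_cast
    ring_nf
  · have g_one_eq : g 1 = g 0 := by simp [hg]
    rw [g_one_eq, div_self (g_ne_zero 0), one_mul]
    simp only [hg]
    push_cast
    ring_nf

end ContentFactor

namespace YoungGraph

theorem prod_contentFactor_cells {K : Type*} [Field K] {z : K} (hz : ∀ n : ℤ, z ≠ n)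
    (ρ : YoungDiagram) :
    ∏ b ∈ ρ.cells, contentFactor z (boxContent b) = z * rowRatio ρ z := by
  have z_add_ne_zero (i : ℕ) : z + i ≠ 0 := fun h =>
    hz (-i) (by push_cast; linear_combination h)
  have row_last : (rowContent ρ (rows ρ).support.card : K) = -(rows ρ).support.card := by
    rw [rowContent, isRowGraph.row_eq_zero le_rfl]
    simp
  have prod_row (i : ℕ) : ∏ j ∈ range (rows ρ i), contentFactor z (boxContent (i, 0 + j) : K) =
      (z + i) / (z + (i + 1 : ℕ)) * ((z - (rowContent ρ i - 1)) / (z - rowContent ρ i)) := by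
    simpa [boxContent, rowContent] using prod_contentFactor_row hz i (rows ρ i)
  rw [isRowGraph.prod_cells, prod_congr rfl fun i _ => prod_row i, prod_mul_distrib,
    prod_range_div_succ z_add_ne_zero, prod_div_distrib, rowRatio, prod_range_succ, row_last,
    sub_neg_eq_add, div_mul_div_comm, Nat.cast_zero, add_zero, mul_div_assoc', mul_comm (z + _)]

end YoungGraph

namespace StrictPartition

theorem mem_double_cells (lam : StrictPartition) (a b : ℕ) :
    (a, b) ∈ lam.double.cells ↔
      (a < b ∧ b ≤ a + lam.part a) ∨ (b ≤ a ∧ a < b + lam.part b) := by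
  refine (mem_doubleCells lam a b).trans ?_
  rcases lt_or_ge a b with h | h
  · rw [min_eq_left h.le]
    omega
  · rw [min_eq_right h]
    omega

theorem double_cells_eq_union (lam : StrictPartition) : lam.double.cells =
    lam.cells.image (fun b => (b.1, b.2 + 1)) ∪ lam.cells.image Prod.swap := by
  ext ⟨a, b⟩
  simp only [mem_double_cells, mem_union, mem_image, Prod.exists, mem_cells, Prod.swap_prod_mk,
    Prod.mk.injEq]
  constructor
  · rintro (h | h)
    · exact .inl ⟨a, b - 1, by omega, rfl, by omega⟩
    · exact .inr ⟨b, a, h, rfl, rfl⟩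
  · rintro (⟨a, b, h, rfl, rfl⟩ | ⟨b, a, h, rfl, rfl⟩)
    · exact .inl (by omega)
    · exact .inr h

theorem prod_double_cells {M : Type*} [CommMonoid M] (lam : StrictPartition) (f : ℕ × ℕ → M) :
    ∏ b ∈ lam.double.cells, f b = ∏ b ∈ lam.cells, f (b.1, b.2 + 1) * f (b.2, b.1) := by
  have disjoint : Disjoint (lam.cells.image fun b => (b.1, b.2 + 1))
      (lam.cells.image Prod.swap) := by
    simp only [disjoint_left, mem_image, Prod.exists, not_exists, not_and]
    rintro _ ⟨a, b, h, rfl⟩ c d h' heq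
    rw [mem_cells] at h h'
    grind
  rw [double_cells_eq_union, prod_union disjoint, prod_image, prod_image, prod_mul_distrib]
  · rfl
  · exact Prod.swap_injective.injOn
  · exact fun b _ b' _ h => by grind

theorem rowRatio_double {K : Type*} [Field K] {z : K} (hz : ∀ n : ℤ, z ≠ n)
    (lam : StrictPartition) :
    (z - 1) * lam.rowRatio (z * (z - 1)) = YoungGraph.rowRatio lam.double z := by
  have z_ne_zero : z ≠ 0 := by simpa using hz 0
  have z_sub_one_ne_zero : z - 1 ≠ 0 := sub_ne_zero.2 (by simpa using hz 1)
  have prod_row (i : ℕ) : ∏ j ∈ range (lam.part i),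
      contentFactor z (boxContent (i, i + j + 1) : K) * contentFactor z (boxContent (i + j, i)) =
      (z * (z - 1) - lam.part i * (lam.part i - 1)) /
        (z * (z - 1) - lam.part i * (lam.part i + 1)) := by
    simpa [boxContent, add_assoc] using prod_contentFactor_shiftedRow hz (lam.part i)
  have prod_cells : ∏ b ∈ lam.double.cells, contentFactor z (boxContent b : K) =
      z * (z - 1) * lam.rowRatio (z * (z - 1)) := by
    rw [prod_double_cells, isRowGraph.prod_cells]
    simp only [id, prod_row]
    rw [prod_div_distrib, rowRatio, length, prod_range_succ, ← length, part_length,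
      Nat.cast_zero, zero_mul, sub_zero, mul_div_assoc', mul_comm (_ * _) (∏ i ∈ _, _),
      mul_div_mul_right _ _ (mul_ne_zero z_ne_zero z_sub_one_ne_zero)]
  refine mul_left_cancel₀ z_ne_zero ?_
  rw [← YoungGraph.prod_contentFactor_cells hz, prod_cells, mul_assoc]

end StrictPartition

theorem prod_corner_div_prod_corner {K : Type*} [Field K] {S T : ℕ → Prop} [DecidablePred S]
    [DecidablePred T] {R A : ℕ → K} {n : ℕ} (hT : T 0) (hST : ∀ i < n, T (i + 1) ↔ S i)
    (hRA : ∀ i < n, ¬ S i → R i = A (i + 1)) (hA : ∀ i, A i ≠ 0) :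
    (∏ i ∈ range n with S i, R i) / ∏ i ∈ range (n + 1) with T i, A i =
      (∏ i ∈ range n, R i) / ∏ i ∈ range (n + 1), A i := by
  rw [prod_filter, prod_filter, prod_range_succ', prod_range_succ' A, if_pos hT, ← div_div,
    ← div_div, ← prod_div_distrib, ← prod_div_distrib]
  congr 1
  refine prod_congr rfl fun i hi => ?_
  rw [mem_range] at hi
  by_cases hS : S i
  · rw [if_pos hS, if_pos ((hST i hi).2 hS)]
  · rw [if_neg hS, if_neg (mt (hST i hi).1 hS), hRA i hi hS, div_self (hA _), div_one]

theorem ratFunc_X_ne_intCast {K : Type*} [Field K] (n : ℤ) : (RatFunc.X : RatFunc K) ≠ n := by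
  intro h
  refine RatFunc.transcendental_X (K := K) (h ▸ ?_)
  exact map_intCast (algebraMap K (RatFunc K)) n ▸ isAlgebraic_algebraMap (n : K)

theorem ratFunc_eval_prod_div_prod.{u} {ι : Type*} {K L : Type u} [Field K] [Field L] (f : K →+* L)
    {s t : Finset ι} {a x : ι → K} {v : L} (hx : ∀ j ∈ t, v ≠ f (x j)) :
    RatFunc.eval f v ((∏ i ∈ s, (RatFunc.X - RatFunc.C (a i))) /
        ∏ j ∈ t, (RatFunc.X - RatFunc.C (x j))) =
      (∏ i ∈ s, (v - f (a i))) / ∏ j ∈ t, (v - f (x j)) := by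
  have algebraMap_prod (s : Finset ι) (a : ι → K) : ∏ i ∈ s, (RatFunc.X - RatFunc.C (a i)) =
      algebraMap (Polynomial K) (RatFunc K) (∏ i ∈ s, (Polynomial.X - Polynomial.C (a i))) := by
    simp
  have eval₂_prod (s : Finset ι) (a : ι → K) :
      (∏ i ∈ s, (Polynomial.X - Polynomial.C (a i))).eval₂ f v = ∏ i ∈ s, (v - f (a i)) := by
    simp [Polynomial.eval₂_finsetProd]
  rw [algebraMap_prod, algebraMap_prod, ← eval₂_prod, ← eval₂_prod]
  set p := ∏ i ∈ s, (Polynomial.X - Polynomial.C (a i))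
  set q := ∏ j ∈ t, (Polynomial.X - Polynomial.C (x j))
  have hq : q.eval₂ f v ≠ 0 := by
    rw [eval₂_prod]
    exact prod_ne_zero_iff.2 fun j hj => sub_ne_zero.2 (hx j hj)
  have hq_ne_zero : q ≠ 0 := fun h => hq (by rw [h, Polynomial.eval₂_zero])
  have eval₂_denom_ne_zero : (algebraMap _ (RatFunc K) p / algebraMap _ _ q).denom.eval₂ f v ≠ 0 :=
    fun h => hq (Polynomial.eval₂_eq_zero_of_dvd_of_eval₂_eq_zero f v
      (RatFunc.denom_div_dvd p q) h)
  have eval₂_algebraMap (p : Polynomial K) :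
      RatFunc.eval f v (algebraMap _ (RatFunc K) p) = p.eval₂ f v := by
    simp [RatFunc.eval_algebraMap]
  rw [eq_div_iff hq, ← eval₂_algebraMap q, ← RatFunc.eval_mul _ _ eval₂_denom_ne_zero (by simp),
    div_mul_cancel₀ _ (RatFunc.algebraMap_ne_zero hq_ne_zero), eval₂_algebraMap]

namespace YoungGraph

theorem kerovR_eq_rowRatio (ρ : YoungDiagram) : ρ.kerovR = rowRatio ρ RatFunc.X := by
  have removable_prod := isRowGraph.prod_removable (fun b => ρ.removable_finite.mem_toFinset)
    (fun i => exists_add_single_eq_rows_iff)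
    fun b => (RatFunc.X - RatFunc.C (boxContent b : ℂ) : RatFunc ℂ)
  have addable_prod := isRowGraph.prod_addable (fun b => ρ.addable_finite.mem_toFinset)
    (fun i => exists_rows_eq_add_single_iff)
    fun b => (RatFunc.X - RatFunc.C (boxContent b : ℂ) : RatFunc ℂ)
  have removable_factor {i : ℕ} (hi : rows ρ (i + 1) < rows ρ i) :
      (RatFunc.X - RatFunc.C (boxContent (i, 0 + (rows ρ i - 1)) : ℂ) : RatFunc ℂ) =
        RatFunc.X - ((rowContent ρ i : RatFunc ℂ) - 1) := by
    have : boxContent (i, 0 + (rows ρ i - 1)) = rowContent ρ i - 1 := by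
      unfold boxContent rowContent
      omega
    rw [this]
    simp
  have addable_factor (i : ℕ) :
      (RatFunc.X - RatFunc.C (boxContent (i, 0 + rows ρ i) : ℂ) : RatFunc ℂ) =
        RatFunc.X - (rowContent ρ i : RatFunc ℂ) := by
    simp [boxContent, rowContent]
  rw [YoungDiagram.kerovR, removable_prod, addable_prod, rowRatio,
    prod_congr rfl fun i hi => removable_factor (mem_filter.1 hi).2,
    prod_congr rfl fun i _ => addable_factor i]
  refine prod_corner_div_prod_corner (.inl rfl) (fun i _ => by simp) (fun i _ hi => ?_)
    fun i => sub_ne_zero.2 (ratFunc_X_ne_intCast _)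
  have := rows_antitone ρ (Nat.le_add_right i 1)
  have : rowContent ρ i - 1 = rowContent ρ (i + 1) := by
    unfold rowContent
    omega
  exact_mod_cast congrArg (fun c : ℤ => (RatFunc.X : RatFunc ℂ) - (c : RatFunc ℂ)) this

end YoungGraph

namespace StrictPartition

variable (lam : StrictPartition)

theorem prod_removable {M : Type*} [CommMonoid M] (f : ℕ × ℕ → M) :
    ∏ b ∈ lam.removable_finite.toFinset, f b =
      ∏ i ∈ range lam.length with lam.part (i + 1) + 1 < lam.part i ∨ lam.part (i + 1) = 0,
        f (i, i + (lam.part i - 1)) := by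
  rw [isRowGraph.prod_removable (fun b => lam.removable_finite.mem_toFinset)
    (fun i => exists_add_single_eq_part_iff) f]
  refine prod_congr (filter_congr fun i hi => ?_) fun i _ => rfl
  exact and_iff_right (part_ne_zero_iff.2 (mem_range.1 hi))

open Classical in
theorem prod_addable_boxContent_ne_zero {M : Type*} [CommMonoid M] (f : ℕ × ℕ → M) :
    ∏ b ∈ lam.addable_finite.toFinset with boxContent b ≠ 0, f b =
      ∏ i ∈ range lam.length with i = 0 ∨ lam.part i + 1 < lam.part (i - 1),
        f (i, i + lam.part i) := by
  rw [prod_filter, isRowGraph.prod_addable (fun b => lam.addable_finite.mem_toFinset)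
    (fun i => exists_part_eq_add_single_iff), prod_filter, prod_range_succ, prod_filter, ← length]
  have last_content : boxContent (lam.length, lam.length + lam.part lam.length) = 0 := by
    simp [boxContent, part_length]
  simp only [id, last_content, ne_eq, not_true, if_false, ite_self, mul_one]
  refine prod_congr rfl fun i hi => ?_
  have part_ne_zero : lam.part i ≠ 0 := part_ne_zero_iff.2 (mem_range.1 hi)
  simp [boxContent, part_ne_zero]

theorem kerovR_eq_rowRatio : lam.kerovR = lam.rowRatio RatFunc.X := by
  set A : ℕ → RatFunc ℂ := fun i => 
    RatFunc.X - (lam.part i : RatFunc ℂ) * ((lam.part i : RatFunc ℂ) + 1) with hA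
  have X_mul_prod : (RatFunc.X : RatFunc ℂ) * ∏ i ∈ range lam.length with
        i = 0 ∨ lam.part i + 1 < lam.part (i - 1), A i =
      ∏ i ∈ range (lam.length + 1) with
        i = 0 ∨ lam.part i + 1 < lam.part (i - 1) ∨ lam.part i = 0, A i := by
    rw [prod_filter, prod_filter, prod_range_succ, if_pos (by simp [part_length]), mul_comm]
    congr 1
    · refine prod_congr rfl fun i hi => ?_
      simp [part_ne_zero_iff.2 (mem_range.1 hi)]
    · simp [hA, part_length]
  have removable_factor {i : ℕ} (hi : i < lam.length) :
      (RatFunc.X - RatFunc.C ((boxContent (i, i + (lam.part i - 1)) : ℂ) *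
        ((boxContent (i, i + (lam.part i - 1)) : ℂ) + 1)) : RatFunc ℂ) =
        RatFunc.X - (lam.part i : RatFunc ℂ) * ((lam.part i : RatFunc ℂ) - 1) := by
    have part_ne_zero : lam.part i ≠ 0 := part_ne_zero_iff.2 hi
    have : boxContent (i, i + (lam.part i - 1)) = (lam.part i : ℤ) - 1 := by
      unfold boxContent
      omega
    simp [this, mul_comm]
  have addable_factor (i : ℕ) :
      (RatFunc.X - RatFunc.C ((boxContent (i, i + lam.part i) : ℂ) *
        ((boxContent (i, i + lam.part i) : ℂ) + 1)) : RatFunc ℂ) = A i := by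
    simp [boxContent, hA]
  rw [kerovR, prod_removable, prod_addable_boxContent_ne_zero, rowRatio,
    prod_congr rfl fun i hi => removable_factor (mem_range.1 (mem_filter.1 hi).1),
    prod_congr rfl fun i _ => addable_factor i, X_mul_prod]
  refine prod_corner_div_prod_corner (.inl rfl) (fun i _ => by simp) (fun i hi hS => ?_)
    fun i => ?_
  · have := part_succ_lt lam i (part_ne_zero_iff.2 hi)
    have part_eq : lam.part i = lam.part (i + 1) + 1 := by omega
    rw [hA, part_eq]
    push_cast
    ring
  · rw [hA, sub_ne_zero]
    exact_mod_cast ratFunc_X_ne_intCast (K := ℂ) (lam.part i * (lam.part i + 1))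

theorem eval_kerovR {v : RatFunc ℂ} (hv : ∀ p : ℕ, v ≠ p * (p + 1)) :
    RatFunc.eval RatFunc.C v lam.kerovR = lam.rowRatio v := by
  have := ratFunc_eval_prod_div_prod (RatFunc.C : ℂ →+* RatFunc ℂ) (s := range lam.length)
    (t := range (lam.length + 1)) (a := fun i => (lam.part i : ℂ) * (lam.part i - 1))
    (x := fun i => (lam.part i : ℂ) * (lam.part i + 1)) (v := v) fun i _ => by simpa using hv _
  simpa [kerovR_eq_rowRatio, rowRatio] using this

theorem kerovR_double :
    (RatFunc.X - 1) *
        RatFunc.eval (RatFunc.C : ℂ →+* RatFunc ℂ) (RatFunc.X * (RatFunc.X - 1)) lam.kerovR =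
      lam.double.kerovR := by
  have X_mul_X_sub_one_ne (p : ℕ) : (RatFunc.X * (RatFunc.X - 1) : RatFunc ℂ) ≠ p * (p + 1) := by
    intro h
    have := mul_ne_zero (sub_ne_zero.2 (ratFunc_X_ne_intCast (K := ℂ) (p + 1)))
      (sub_ne_zero.2 (ratFunc_X_ne_intCast (K := ℂ) (-p)))
    push_cast at this
    exact this (by linear_combination h)
  rw [eval_kerovR lam X_mul_X_sub_one_ne, rowRatio_double ratFunc_X_ne_intCast,
    YoungGraph.kerovR_eq_rowRatio]

end StrictPartition

theorem eventually_ne_intCast (c : ℝ) : ∀ᶠ z : ℝ in 𝓝[≠] c, ∀ n : ℤ, z ≠ n := by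
  have isClosed_image : IsClosed ((↑) '' {n : ℤ | (n : ℝ) ≠ c} : Set ℝ) :=
    Int.isClosedEmbedding_coe_real.isClosedMap _ (isClosed_discrete _)
  have notMem_image : c ∉ ((↑) '' {n : ℤ | (n : ℝ) ≠ c} : Set ℝ) := fun ⟨_, hn, hnc⟩ => hn hnc
  filter_upwards [self_mem_nhdsWithin,
    nhdsWithin_le_nhds (isClosed_image.isOpen_compl.mem_nhds notMem_image)] with z hz hz' n rfl
  exact hz' ⟨n, hz, rfl⟩

namespace YoungGraph

variable {σ ρ τ : YoungDiagram} {b b' : ℕ × ℕ}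

theorem covers_iff_covBy : σ.Covers ρ ↔ σ.cells ⋖ ρ.cells := by
  rw [YoungDiagram.Covers, ← YoungDiagram.cells_subset_iff, covBy_iff_card_sdiff_eq_one]
  refine and_congr_right fun hsub => ?_
  rw [card_sdiff_of_subset hsub, YoungDiagram.card, YoungDiagram.card]
  have := card_le_card hsub
  omega

theorem covers_and_covers_iff (hτ : τ.cells = insert b (insert b' σ.cells)) (hb : b ∉ σ.cells)
    (hb' : b' ∉ σ.cells) (hne : b ≠ b') :
    σ.Covers ρ ∧ ρ.Covers τ ↔ ρ.cells = insert b σ.cells ∨ ρ.cells = insert b' σ.cells := by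
  rw [covers_iff_covBy, covers_iff_covBy, hτ]
  constructor
  · rintro ⟨hσρ, hρτ⟩
    obtain ⟨x, hx, hρ⟩ := covBy_iff_exists_insert.1 hσρ
    have hxτ := hρτ.le (hρ ▸ mem_insert_self x _)
    rw [mem_insert, mem_insert, or_iff_left hx] at hxτ
    rcases hxτ with rfl | rfl
    · exact .inl hρ.symm
    · exact .inr hρ.symm
  · rintro (hρ | hρ) <;> rw [hρ]
    · exact ⟨covBy_insert hb, insert_comm b b' σ.cells ▸ covBy_insert (by simp [hne.symm, hb'])⟩
    · exact ⟨covBy_insert hb', covBy_insert (by simp [hne, hb])⟩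

theorem exists_cells_eq_insert (hτ : τ.cells = insert b (insert b' σ.cells)) (hb : ¬ b' ≤ b) :
    ∃ ρ : YoungDiagram, ρ.cells = insert b σ.cells := by
  refine ⟨⟨insert b σ.cells, fun x y hyx hx => ?_⟩, rfl⟩
  rw [mem_coe, mem_insert] at hx ⊢
  rcases hx with rfl | hx
  · have hy : y ∈ τ.cells := τ.isLowerSet hyx (hτ ▸ mem_insert_self x _)
    rw [hτ, mem_insert, mem_insert] at hy
    exact hy.imp_right fun h => h.resolve_left (by rintro rfl; exact hb hyx)
  · exact .inr (σ.isLowerSet hyx hx)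

theorem mem_of_le_of_cells_eq_insert (hρ : ρ.cells = insert b σ.cells) (hle : b' ≤ b)
    (hne : b' ≠ b) : b' ∈ σ.cells :=
  mem_of_mem_insert_of_ne (hρ ▸ ρ.isLowerSet hle (hρ ▸ mem_insert_self b _)) hne

theorem hasResidueAt_rowRatio_boxContent (hb : b ∉ σ.cells) (hρ : ρ.cells = insert b σ.cells) :
    HasResidueAt (rowRatio σ : ℝ → ℝ) (boxContent b) (σ.plancherelUp ρ) := by
  obtain ⟨i, hi⟩ := isRowGraph.edge_iff_exists.1 (covers_iff_covBy.2 (hρ ▸ covBy_insert hb))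
  have content_eq : boxContent b = rowContent σ i := by
    rw [isRowGraph.eq_of_mem_cells hi (hρ ▸ mem_insert_self b _) hb]
    simp [boxContent, rowContent]
  exact content_eq ▸ hasResidueAt_rowRatio hi

end YoungGraph

namespace StrictPartition

variable (mu : StrictPartition) (i : ℕ)

/-- The box added to the `i`-th arm of the double of `mu` when the `i`-th part of `mu` grows by
one. -/
def armBox : ℕ × ℕ := (i, i + mu.part i + 1)

/-- The box added to the `i`-th leg of the double of `mu` when the `i`-th part of `mu` grows by
one. -/
def legBox : ℕ × ℕ := (i + mu.part i, i)

theorem armBox_notMem_double : mu.armBox i ∉ mu.double.cells := by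
  rw [armBox, mem_double_cells]
  omega

theorem legBox_notMem_double : mu.legBox i ∉ mu.double.cells := by
  rw [legBox, mem_double_cells]
  rcases Nat.eq_zero_or_pos (mu.part i) with h | h
  · simp [h]
  · omega

theorem not_armBox_le_legBox : ¬ mu.armBox i ≤ mu.legBox i := by
  rw [armBox, legBox, Prod.mk_le_mk]
  omega

theorem legBox_le_armBox_iff : mu.legBox i ≤ mu.armBox i ↔ mu.part i = 0 := by
  rw [armBox, legBox, Prod.mk_le_mk]
  omega

theorem armBox_ne_legBox : mu.armBox i ≠ mu.legBox i :=
  fun h => mu.not_armBox_le_legBox i h.le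

theorem boxContent_armBox : boxContent (mu.armBox i) = mu.part i + 1 := by
  rw [armBox, boxContent]
  omega

theorem boxContent_legBox : boxContent (mu.legBox i) = -mu.part i := by
  rw [legBox, boxContent]
  omega

variable {mu i} {lam : StrictPartition} (h : lam.part = mu.part + Finsupp.single i 1)
  {ρ : YoungDiagram}
include h

theorem double_cells_eq_insert :
    lam.double.cells = insert (mu.armBox i) (insert (mu.legBox i) mu.double.cells) := by
  rw [double_cells_eq_union, double_cells_eq_union, isRowGraph.cells_eq_insert h, image_insert,
    image_insert, insert_union, union_insert]
  rfl

theorem plancherelUp_double {b : ℕ × ℕ} (hb : b ∉ mu.double.cells)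
    (hρ : ρ.cells = insert b mu.double.cells)
    (hc : (boxContent b : ℝ) * (boxContent b - 1) = mu.part i * (mu.part i + 1)) :
    mu.double.plancherelUp ρ =
      (boxContent b - 1) / (2 * boxContent b - 1) * mu.plancherelUp lam := by
  have two_mul_sub_one_ne_zero : (boxContent b : ℝ) + boxContent b - 1 ≠ 0 := by
    exact_mod_cast show boxContent b + boxContent b - 1 ≠ 0 by omega
  have residue_comp : HasResidueAt (fun z : ℝ => mu.rowRatio (z * (z - 1))) (boxContent b)
      (mu.plancherelUp lam / (boxContent b + boxContent b - 1)) :=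
    .comp (φ := fun z : ℝ => z * (z - 1)) (g := fun z : ℝ => z + boxContent b - 1)
      (hc ▸ hasResidueAt_rowRatio h)
      (fun z => by ring) (by fun_prop) two_mul_sub_one_ne_zero
  have residue_double := (residue_comp.mul_continuousAt (g := fun z => z - 1) (by fun_prop)).congr'
    ((eventually_ne_intCast _).mono fun z hz => (mul_comm _ _).trans (rowRatio_double hz mu))
  rw [(YoungGraph.hasResidueAt_rowRatio_boxContent hb hρ).unique residue_double]
  ring

theorem plancherelUp_double_armBox (hρ : ρ.cells = insert (mu.armBox i) mu.double.cells) :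
    mu.double.plancherelUp ρ = mu.part i / (2 * mu.part i + 1) * mu.plancherelUp lam := by
  rw [plancherelUp_double h (mu.armBox_notMem_double i) hρ] <;> rw [boxContent_armBox] <;>
    push_cast <;> ring

theorem plancherelUp_double_legBox (hρ : ρ.cells = insert (mu.legBox i) mu.double.cells) :
    mu.double.plancherelUp ρ = (mu.part i + 1) / (2 * mu.part i + 1) * mu.plancherelUp lam := by
  rw [plancherelUp_double h (mu.legBox_notMem_double i) hρ] <;> rw [boxContent_legBox] <;>
    push_cast
  · rw [← neg_div_neg_eq]
    ring
  · ring

theorem double_covers_and_covers_double_iff :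
    mu.double.Covers ρ ∧ ρ.Covers lam.double ↔
      ρ.cells = insert (mu.armBox i) mu.double.cells ∨
        ρ.cells = insert (mu.legBox i) mu.double.cells :=
  YoungGraph.covers_and_covers_iff (double_cells_eq_insert h) (mu.armBox_notMem_double i)
    (mu.legBox_notMem_double i) (mu.armBox_ne_legBox i)

theorem exists_cells_eq_insert_armBox (hi : mu.part i ≠ 0) :
    ∃ ρ : YoungDiagram, ρ.cells = insert (mu.armBox i) mu.double.cells :=
  YoungGraph.exists_cells_eq_insert (double_cells_eq_insert h)
    (mt (mu.legBox_le_armBox_iff i).1 hi)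

theorem exists_cells_eq_insert_legBox :
    ∃ ρ : YoungDiagram, ρ.cells = insert (mu.legBox i) mu.double.cells :=
  YoungGraph.exists_cells_eq_insert ((double_cells_eq_insert h).trans (insert_comm _ _ _))
    (mu.not_armBox_le_legBox i)

theorem exists_covers_double_pair (hi : mu.part i ≠ 0) :
    ∃ ρa ρb : YoungDiagram, ρa ≠ ρb ∧
      (∀ ρ : YoungDiagram, mu.double.Covers ρ ∧ ρ.Covers lam.double ↔ ρ = ρa ∨ ρ = ρb) ∧
      mu.plancherelUp lam = mu.double.plancherelUp ρa + mu.double.plancherelUp ρb := by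
  obtain ⟨ρa, hρa⟩ := exists_cells_eq_insert_armBox h hi
  obtain ⟨ρb, hρb⟩ := exists_cells_eq_insert_legBox h
  refine ⟨ρa, ρb, ?_, fun ρ => ?_, ?_⟩
  · rintro rfl
    exact mu.armBox_ne_legBox i
      ((insert_inj (mu.armBox_notMem_double i)).1 (hρa.symm.trans hρb))
  · rw [double_covers_and_covers_double_iff h, ← hρa, ← hρb, ← YoungDiagram.ext_iff,
      ← YoungDiagram.ext_iff]
  · rw [plancherelUp_double_armBox h hρa, plancherelUp_double_legBox h hρb]
    field_simp
    ring

theorem exists_covers_double_of_part_eq_zero (hi : mu.part i = 0) :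
    ∃ ρ₀ : YoungDiagram,
      (∀ ρ : YoungDiagram, mu.double.Covers ρ ∧ ρ.Covers lam.double ↔ ρ = ρ₀) ∧
      mu.plancherelUp lam = mu.double.plancherelUp ρ₀ := by
  obtain ⟨ρ₀, hρ₀⟩ := exists_cells_eq_insert_legBox h
  refine ⟨ρ₀, fun ρ => ?_, by simp [plancherelUp_double_legBox h hρ₀, hi]⟩
  have armBox_not_first : ρ.cells ≠ insert (mu.armBox i) mu.double.cells := fun hρ =>
    mu.legBox_notMem_double i <| YoungGraph.mem_of_le_of_cells_eq_insert hρ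
      ((mu.legBox_le_armBox_iff i).2 hi) (mu.armBox_ne_legBox i).symm
  rw [double_covers_and_covers_double_iff h, or_iff_right armBox_not_first, ← hρ₀,
    ← YoungDiagram.ext_iff]

end StrictPartition

theorem mainTheorem2 :
    (∀ lam : StrictPartition,
      (RatFunc.X - 1) *
          RatFunc.eval (RatFunc.C : ℂ →+* RatFunc ℂ) (RatFunc.X * (RatFunc.X - 1)) lam.kerovR =
        lam.double.kerovR) ∧
    ∀ mu lam : StrictPartition, mu.Covers lam →
      (lam.length = mu.length →
        ∃ ρa ρb : YoungDiagram, ρa ≠ ρb ∧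
          (∀ ρ : YoungDiagram,
            (mu.double.Covers ρ ∧ ρ.Covers lam.double) ↔ (ρ = ρa ∨ ρ = ρb)) ∧
          mu.plancherelUp lam =
            mu.double.plancherelUp ρa + mu.double.plancherelUp ρb) ∧
      (lam.length ≠ mu.length →
        lam.length = mu.length + 1 ∧
        ∃ ρ₀ : YoungDiagram,
          (∀ ρ : YoungDiagram,
            (mu.double.Covers ρ ∧ ρ.Covers lam.double) ↔ ρ = ρ₀) ∧
          mu.plancherelUp lam = mu.double.plancherelUp ρ₀) := by
  refine ⟨StrictPartition.kerovR_double, fun mu lam hcov => ?_⟩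
  obtain ⟨i, h⟩ := StrictPartition.isRowGraph.edge_iff_exists.1 hcov
  by_cases hi : mu.part i = 0
  · obtain ⟨-, hlength⟩ := StrictPartition.length_of_part_eq_zero h hi
    exact ⟨fun hl => by omega, fun _ =>
      ⟨hlength, StrictPartition.exists_covers_double_of_part_eq_zero h hi⟩⟩
  · have hlength := StrictPartition.length_of_part_ne_zero h hi
    exact ⟨fun _ => StrictPartition.exists_covers_double_pair h hi, fun hl => absurd hlength hl⟩
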